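/- Corollary 2. For integers $n_1,n_2\ge 1$ and $p$, put $N=n_1+n_2$ and $\nu_2=N-2$. Let $X_1,\dots,X_{n_1}$ be i.i.d. $N_p(\mu_1,\Sigma)$ random vectors and $Y_1,\dots,Y_{n_2}$ be i.i.d. $N_p(\mu_2,\Sigma)$ random vectors, the two samples being independent, where the common covariance matrix $\Sigma$ is diagonal with positive diagonal entries. Let $\bar X_j,\bar Y_j$ be the $j$-th coordinates of the sample means, $$s_{j,\mathrm{pool}}^2=\frac1{N-2}\Big\{\sum_{i=1}^{n_1}(X_{ij}-\bar X_j)^2+\sum_{i=1}^{n_2}(Y_{ij}-\bar Y_j)^2\Big\},\qquad t_{Nj}=\sqrt{\frac{n_1n_2}{N}}\;\frac{\bar X_j-\bar Y_j}{s_{j,\mathrm{pool}}},$$ $$T_2=N\sum_{j=1}^p\log\Big(1+\frac{t_{Nj}^2}{\nu_2}\Big).$$ With $\Psi=\Gamma'/\Gamma$ and $D(x)=\Psi\{(x+1)/2\}-\Psi(x/2)$, let $G_1=N D(\nu_2)$ and $G_2=N^2\{D(\nu_2)^2-2D'(\nu_2)\}$. Then, under the null hypothesis $\mu_1=\mu_2$: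 (a) For any fixed $N\ge 4$, $\ (T_2-pG_1)/\sqrt{p(G_2-G_1^2)}\to N(0,1)$ in distribution as $p\to\infty$. (b) Let $k$ be a fixed positive integer with $k<\nu_2/2$. If $p=o(N^{2k})$, then $(T_2-p\eta_k)/\sqrt{2p}\to N(0,1)$ in distribution as $(N,p)\to\infty$, where $$\eta_k=N\sum_{i=1}^k\frac{(-1)^{i+1}}{i}\,b_i,\qquad b_i=\prod_{l=1}^{i}\frac{2l-1}{\nu_2-2l}.$$ Here $n_1$, $n_2$, $\mu_1=\mu_2$ and $\Sigma$ may vary arbitrarily along the limit (subject to $n_1+n_2=N$), and limits are understood along arbitrary sequences of such experiments. -/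

import Mathlib

open MeasureTheory ProbabilityTheory Filter Asymptotics

noncomputable section

namespace DLRT

variable {n₁ n₂ p : ℕ}

/-- The digamma function `Ψ = Γ' / Γ` on the reals. -/
def digamma (x : ℝ) : ℝ := deriv Real.Gamma x / Real.Gamma x

/-- `D x = Ψ((x + 1) / 2) - Ψ(x / 2)`. -/
def D (x : ℝ) : ℝ := digamma ((x + 1) / 2) - digamma (x / 2)

/-- The degrees of freedom `ν₂ = N - 2`, as a real number. -/
def nu₂ (N : ℕ) : ℝ := (N : ℝ) - 2

/-- `G₁ = N D(ν₂)`. -/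
def G₁ (N : ℕ) : ℝ := (N : ℝ) * D (nu₂ N)

/-- `G₂ = N² {D(ν₂)² - 2 D'(ν₂)}`. -/
def G₂ (N : ℕ) : ℝ := (N : ℝ) ^ 2 * (D (nu₂ N) ^ 2 - 2 * deriv D (nu₂ N))

/-- `b_i = ∏_{l=1}^{i} (2 l - 1) / (ν₂ - 2 l)`. -/
def b (N i : ℕ) : ℝ := ∏ l ∈ Finset.Icc 1 i, (2 * (l : ℝ) - 1) / (nu₂ N - 2 * (l : ℝ))

/-- `η_k = N {b₁ - b₂ / 2 + ⋯ + (-1)^(k+1) b_k / k}`. -/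
def eta (N k : ℕ) : ℝ := (N : ℝ) * ∑ i ∈ Finset.Icc 1 k, (-1 : ℝ) ^ (i + 1) * b N i / (i : ℝ)

/-- The `j`-th coordinate of the sample mean of `x₁, …, x_n`. -/
def sampleMean {n : ℕ} (x : Fin n → EuclideanSpace ℝ (Fin p)) (j : Fin p) : ℝ :=
  (∑ i, x i j) / (n : ℝ)

/-- The pooled sample covariance matrix `S` of two samples in `ℝᵖ`. -/
def pooledCov (x : Fin n₁ → EuclideanSpace ℝ (Fin p)) (y : Fin n₂ → EuclideanSpace ℝ (Fin p)) :
    Matrix (Fin p) (Fin p) ℝ :=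
  Matrix.of fun a c =>
    (∑ i, (x i a - sampleMean x a) * (x i c - sampleMean x c) +
      ∑ i, (y i a - sampleMean y a) * (y i c - sampleMean y c)) / nu₂ (n₁ + n₂)

/-- The two-sample `t`-statistic of the `j`-th coordinate,
`t_{Nj} = √(n₁ n₂ / N) (X̄_j - Ȳ_j) / s_{j,pool}`. -/
def tStat (x : Fin n₁ → EuclideanSpace ℝ (Fin p)) (y : Fin n₂ → EuclideanSpace ℝ (Fin p))
    (j : Fin p) : ℝ :=
  √((n₁ : ℝ) * (n₂ : ℝ) / ((n₁ + n₂ : ℕ) : ℝ)) * (sampleMean x j - sampleMean y j) /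
    √(pooledCov x y j j)

/-- The two-sample diagonal likelihood ratio statistic
`T₂ = N ∑_j log(1 + t_{Nj}² / ν₂)`, with `N = n₁ + n₂`. -/
def T₂ (x : Fin n₁ → EuclideanSpace ℝ (Fin p)) (y : Fin n₂ → EuclideanSpace ℝ (Fin p)) : ℝ :=
  ((n₁ + n₂ : ℕ) : ℝ) * ∑ j, Real.log (1 + tStat x y j ^ 2 / nu₂ (n₁ + n₂))

end DLRT

end

/-!
Under the null hypothesis the summands `N log (1 + t_{Nj}² / ν₂)` of `T₂` are independent over `j`,
and each of them has the law of `N log (1 + U / V)` with `U`, `V` independent gamma variables of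
shapes `1/2` and `ν₂/2`; so `T₂` is a sum of a row-wise i.i.d. triangular array whose common law
depends on `N` only, and both parts are instances of one central limit theorem for such arrays.

*Independence* (`iIndepFun_coordinates`). The observations are jointly Gaussian, and a diagonal
covariance matrix makes different coordinates uncorrelated.

*Law of a summand* (`map_ratioStat_pi_gaussianReal`). In an orthonormal basis whose first two
vectors are the normalized contrast of the two samples and the normalized constant vector, `t² / ν₂`
is the square of the first coordinate over the sum of the squares of the last `ν₂` coordinates.
The density of a ratio of independent gamma variables (the beta prime law) comes from two linear
changes of variables (`map_div_add_gammaMeasure_prod`), which also give the chi-square law.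

*Moments*. The integrals of `y ^ c * (1 + y) ^ (-e)` against the beta prime law are quotients of
values of `Γ`. Hence the cumulant generating function of `log (1 + U / V)` is a difference of two
functions `log Γ`, its derivative is `t ↦ D (ν₂ - 2 t)`, and the mean and variance of a summand are
`G₁` and `G₂ - G₁²`. The same integrals give the moments `b N i` of `U / V`, which are of order
`N ^ (-i)`; with Taylor's formula for the logarithm they show, as `N → ∞`, that the variance of a
summand tends to `2`, that its third absolute central moment stays bounded, and that
`G₁ - eta N k = O(N ^ (-k))`. In part (b) the resulting bias of `T₂` is `p O(N ^ (-k))`, which is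
negligible compared with `√p` because `p = o(N ^ (2 k))`.

*Central limit theorem* (`tendstoInDistribution_of_iid_rows`). With bounded third absolute central
moments, the second-order expansion of the characteristic function of a summand is uniform in the
row, and Lévy's theorem applies.
-/

noncomputable section

namespace DLRT

open Set Topology
open scoped ENNReal RealInnerProductSpace

/-! ### The beta prime law as the law of a ratio of gamma variables -/

lemma lintegral_Ioi_eq_mul_comp_mul {c : ℝ} (hc : 0 < c) {f : ℝ → ℝ≥0∞} (hf : Measurable f) :
    ∫⁻ u in Ioi 0, f u = ENNReal.ofReal c * ∫⁻ y in Ioi 0, f (c * y) := by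
  have h := Real.smul_map_volume_mul_left hc.ne'
  rw [abs_of_pos hc] at h
  conv_lhs => rw [← h]
  rw [Measure.restrict_smul, lintegral_smul_measure, Measure.restrict_map (by fun_prop)
    measurableSet_Ioi, lintegral_map hf (by fun_prop), smul_eq_mul]
  congr 3
  ext y
  simp [hc]

lemma lintegral_gammaMeasure {a r : ℝ} {f : ℝ → ℝ≥0∞} (hf : Measurable f) :
    ∫⁻ x, f x ∂(gammaMeasure a r) =
      ENNReal.ofReal (r ^ a / Real.Gamma a) *
        ∫⁻ x in Ioi 0, ENNReal.ofReal (x ^ (a - 1) * Real.exp (-(r * x))) * f x := by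
  have hm : Measurable (gammaPDF a r) := (measurable_gammaPDFReal a r).ennreal_ofReal
  rw [gammaMeasure, lintegral_withDensity_eq_lintegral_mul _ hm hf,
    ← lintegral_const_mul _ (by fun_prop), ← lintegral_indicator measurableSet_Ioi]
  refine lintegral_congr_ae ?_
  filter_upwards [compl_mem_ae_iff.mpr (measure_singleton (0 : ℝ))] with x hx
  rcases lt_or_gt_of_ne hx with h | h
  · simp [gammaPDF_of_neg h, h.le]
  · rw [indicator_of_mem (show x ∈ Ioi 0 from h), Pi.mul_apply, gammaPDF_of_nonneg h.le, mul_assoc,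
      ← mul_assoc (ENNReal.ofReal _), ENNReal.ofReal_mul' (by positivity)]

/-- The beta prime distribution with shape parameters `α` and `β`: the law on `(0, ∞)` with density
proportional to `y ^ (α - 1) * (1 + y) ^ (-(α + β))`. -/
def betaPrimeMeasure (α β : ℝ) : Measure ℝ :=
  (volume.restrict (Ioi 0)).withDensity fun y =>
    ENNReal.ofReal (Real.Gamma (α + β) / (Real.Gamma α * Real.Gamma β) *
      (y ^ (α - 1) * (1 + y) ^ (-(α + β))))

lemma lintegral_betaPrimeMeasure {α β : ℝ} {f : ℝ → ℝ≥0∞} (hf : Measurable f) :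
    ∫⁻ y, f y ∂(betaPrimeMeasure α β) =
      ∫⁻ y in Ioi 0, ENNReal.ofReal (Real.Gamma (α + β) / (Real.Gamma α * Real.Gamma β) *
        (y ^ (α - 1) * (1 + y) ^ (-(α + β)))) * f y := by
  rw [betaPrimeMeasure, lintegral_withDensity_eq_lintegral_mul _ (by fun_prop) hf]
  rfl

/-- For independent gamma variables `U` and `V` of the same rate, the ratio `U / V` and the sum
`U + V` are independent, with a beta prime and a gamma law respectively. Only linear changes of
variables are needed: first `u = v y`, then `v = w / (1 + y)`. -/
lemma map_div_add_gammaMeasure_prod {α β r : ℝ} (hα : 0 < α) (hβ : 0 < β) (hr : 0 < r) :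
    ((gammaMeasure α r).prod (gammaMeasure β r)).map (fun q => (q.1 / q.2, q.1 + q.2)) =
      (betaPrimeMeasure α β).prod (gammaMeasure (α + β) r) := by
  have hΓα := Real.Gamma_pos_of_pos hα
  have hΓβ := Real.Gamma_pos_of_pos hβ
  have hΓαβ := Real.Gamma_pos_of_pos (add_pos hα hβ)
  have := isProbabilityMeasure_gammaMeasure hα hr
  have := isProbabilityMeasure_gammaMeasure hβ hr
  have := isProbabilityMeasure_gammaMeasure (add_pos hα hβ) hr
  refine Measure.ext_of_lintegral _ fun f hf => ?_
  have hu (v : ℝ) (hv : 0 < v) : ENNReal.ofReal (v ^ (β - 1) * Real.exp (-(r * v))) *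
      ∫⁻ u in Ioi 0, ENNReal.ofReal (u ^ (α - 1) * Real.exp (-(r * u))) * f (u / v, u + v) =
      ∫⁻ y in Ioi 0, ENNReal.ofReal (y ^ (α - 1)) *
        (ENNReal.ofReal (v ^ (α + β - 1) * Real.exp (-(r * ((1 + y) * v)))) *
          f (y, (1 + y) * v)) := by
    rw [lintegral_Ioi_eq_mul_comp_mul hv (by fun_prop), ← lintegral_const_mul _ (by fun_prop),
      ← lintegral_const_mul _ (by fun_prop)]
    refine setLIntegral_congr_fun measurableSet_Ioi fun y (hy : 0 < y) => ?_
    rw [mul_div_cancel_left₀ _ hv.ne', show v * y + v = (1 + y) * v by ring]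
    simp only [← mul_assoc (ENNReal.ofReal _)]
    rw [← ENNReal.ofReal_mul (by positivity), ← ENNReal.ofReal_mul (by positivity),
      ← ENNReal.ofReal_mul (by positivity)]
    congr 2
    rw [Real.mul_rpow hv.le hy.le, show α + β - 1 = (α - 1) + (β - 1) + 1 by ring,
      Real.rpow_add hv, Real.rpow_add hv, Real.rpow_one,
      show -(r * ((1 + y) * v)) = -(r * v) + -(r * (v * y)) by ring, Real.exp_add]
    ring
  have hv (y : ℝ) (hy : 0 < y) :
      ∫⁻ v in Ioi 0, ENNReal.ofReal (v ^ (α + β - 1) * Real.exp (-(r * ((1 + y) * v)))) *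
          f (y, (1 + y) * v) =
        ENNReal.ofReal ((1 + y) ^ (-(α + β))) *
          ∫⁻ w in Ioi 0, ENNReal.ofReal (w ^ (α + β - 1) * Real.exp (-(r * w))) * f (y, w) := by
    have hy' : 0 < 1 + y := by positivity
    conv_rhs => rw [lintegral_Ioi_eq_mul_comp_mul hy' (by fun_prop)]
    rw [← lintegral_const_mul _ (by fun_prop), ← lintegral_const_mul _ (by fun_prop)]
    refine setLIntegral_congr_fun measurableSet_Ioi fun v (hv : 0 < v) => ?_
    simp only [← mul_assoc (ENNReal.ofReal _)]
    rw [← ENNReal.ofReal_mul (by positivity), ← ENNReal.ofReal_mul (by positivity)]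
    congr 2
    rw [Real.mul_rpow hy'.le hv.le, Real.rpow_sub_one hy'.ne', Real.rpow_neg hy'.le]
    have := Real.rpow_pos_of_pos hy' (α + β)
    field_simp
  calc ∫⁻ q, f q ∂(((gammaMeasure α r).prod (gammaMeasure β r)).map
          (fun q => (q.1 / q.2, q.1 + q.2)))
      = ∫⁻ v, ∫⁻ u, f (u / v, u + v) ∂(gammaMeasure α r) ∂(gammaMeasure β r) := by
        rw [lintegral_map hf (by fun_prop), lintegral_prod_symm' _ (by fun_prop)]
    _ = ENNReal.ofReal (r ^ β / Real.Gamma β) * (ENNReal.ofReal (r ^ α / Real.Gamma α) *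
          ∫⁻ v in Ioi 0, ∫⁻ y in Ioi 0, ENNReal.ofReal (y ^ (α - 1)) *
            (ENNReal.ofReal (v ^ (α + β - 1) * Real.exp (-(r * ((1 + y) * v)))) *
              f (y, (1 + y) * v))) := by
        rw [lintegral_gammaMeasure (Measurable.lintegral_prod_left'
          (f := fun q : ℝ × ℝ => f (q.1 / q.2, q.1 + q.2)) (by fun_prop))]
        congr 1
        rw [← lintegral_const_mul (ENNReal.ofReal (r ^ α / Real.Gamma α)) (by fun_prop)]
        refine setLIntegral_congr_fun measurableSet_Ioi fun v (hv : 0 < v) => ?_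
        simp only
        rw [lintegral_gammaMeasure (by fun_prop), ← hu v hv, mul_left_comm]
    _ = ∫⁻ y in Ioi 0, ENNReal.ofReal (Real.Gamma (α + β) / (Real.Gamma α * Real.Gamma β) *
          (y ^ (α - 1) * (1 + y) ^ (-(α + β)))) * ∫⁻ w, f (y, w) ∂(gammaMeasure (α + β) r) := by
        rw [lintegral_lintegral_swap (by fun_prop), ← lintegral_const_mul _ (by fun_prop),
          ← lintegral_const_mul _ (by fun_prop)]
        refine setLIntegral_congr_fun measurableSet_Ioi fun y (hy : 0 < y) => ?_
        rw [lintegral_const_mul _ (by fun_prop), hv y hy, lintegral_gammaMeasure (by fun_prop)]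
        simp only [← mul_assoc (ENNReal.ofReal _)]
        rw [← ENNReal.ofReal_mul (by positivity), ← ENNReal.ofReal_mul (by positivity),
          ← ENNReal.ofReal_mul (by positivity), ← ENNReal.ofReal_mul (by positivity)]
        congr 2
        rw [Real.rpow_add hr]
        field_simp
    _ = ∫⁻ q, f q ∂((betaPrimeMeasure α β).prod (gammaMeasure (α + β) r)) := by
        rw [lintegral_prod _ (by fun_prop), lintegral_betaPrimeMeasure (by fun_prop)]

lemma isProbabilityMeasure_betaPrimeMeasure {α β : ℝ} (hα : 0 < α) (hβ : 0 < β) :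
    IsProbabilityMeasure (betaPrimeMeasure α β) := by
  have := isProbabilityMeasure_gammaMeasure hα one_pos
  have := isProbabilityMeasure_gammaMeasure hβ one_pos
  have := isProbabilityMeasure_gammaMeasure (add_pos hα hβ) one_pos
  constructor
  -- both sides of the product formula have the same total mass
  have h := congrArg (fun m : Measure (ℝ × ℝ) => m univ)
    (map_div_add_gammaMeasure_prod hα hβ one_pos)
  simp only [Measure.prod_apply MeasurableSet.univ] at h
  rw [Measure.map_apply (by fun_prop) MeasurableSet.univ] at h
  simpa using h.symm

lemma map_div_gammaMeasure_prod {α β r : ℝ} (hα : 0 < α) (hβ : 0 < β) (hr : 0 < r) :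
    ((gammaMeasure α r).prod (gammaMeasure β r)).map (fun q => q.1 / q.2) =
      betaPrimeMeasure α β := by
  have := isProbabilityMeasure_gammaMeasure (add_pos hα hβ) hr
  have := isProbabilityMeasure_betaPrimeMeasure hα hβ
  have h := congrArg (Measure.map Prod.fst) (map_div_add_gammaMeasure_prod hα hβ hr)
  rwa [Measure.map_map (by fun_prop) (by fun_prop), measurePreserving_fst.map_eq] at h

lemma map_add_gammaMeasure_prod {α β r : ℝ} (hα : 0 < α) (hβ : 0 < β) (hr : 0 < r) :
    ((gammaMeasure α r).prod (gammaMeasure β r)).map (fun q => q.1 + q.2) =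
      gammaMeasure (α + β) r := by
  have := isProbabilityMeasure_gammaMeasure (add_pos hα hβ) hr
  have := isProbabilityMeasure_betaPrimeMeasure hα hβ
  have h := congrArg (Measure.map Prod.snd) (map_div_add_gammaMeasure_prod hα hβ hr)
  rwa [Measure.map_map (by fun_prop) (by fun_prop), measurePreserving_snd.map_eq] at h

lemma ae_pos_betaPrimeMeasure (α β : ℝ) : ∀ᵐ y ∂(betaPrimeMeasure α β), 0 < y :=
  (withDensity_absolutelyContinuous _ _).ae_le (ae_restrict_mem measurableSet_Ioi)

instance nullSingletonClass_betaPrimeMeasure (α β : ℝ) : NullSingletonClass (betaPrimeMeasure α β) := by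
  unfold betaPrimeMeasure; infer_instance

lemma lintegral_rpow_mul_betaPrimeMeasure {α β c e : ℝ} (hα : 0 < α) (hβ : 0 < β)
    (hc : 0 < α + c) (he : 0 < β - c + e) :
    ∫⁻ y, ENNReal.ofReal (y ^ c * (1 + y) ^ (-e)) ∂(betaPrimeMeasure α β) =
      ENNReal.ofReal (Real.Gamma (α + β) / (Real.Gamma α * Real.Gamma β) *
        (Real.Gamma (α + c) * Real.Gamma (β - c + e) / Real.Gamma (α + β + e))) := by
  have hΓα := Real.Gamma_pos_of_pos hα
  have hΓβ := Real.Gamma_pos_of_pos hβ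
  have hΓαβ := Real.Gamma_pos_of_pos (add_pos hα hβ)
  have hΓ1 := Real.Gamma_pos_of_pos hc
  have hΓ2 := Real.Gamma_pos_of_pos he
  have hΓ3 := Real.Gamma_pos_of_pos (show 0 < α + β + e by linarith)
  -- the integrand times the density is a multiple of another beta prime density
  have hone : ∫⁻ y in Ioi 0, ENNReal.ofReal
      (Real.Gamma (α + c + (β - c + e)) / (Real.Gamma (α + c) * Real.Gamma (β - c + e)) *
        (y ^ (α + c - 1) * (1 + y) ^ (-(α + c + (β - c + e))))) = 1 := by
    have := (isProbabilityMeasure_betaPrimeMeasure hc he).measure_univ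
    rwa [betaPrimeMeasure, withDensity_apply _ MeasurableSet.univ, Measure.restrict_univ] at this
  rw [show α + c + (β - c + e) = α + β + e by ring] at hone
  rw [betaPrimeMeasure, lintegral_withDensity_eq_lintegral_mul _ (by fun_prop) (by fun_prop),
    ← mul_one (ENNReal.ofReal (_ * (_ / _))), ← hone, ← lintegral_const_mul _ (by fun_prop)]
  refine setLIntegral_congr_fun measurableSet_Ioi fun y (hy : 0 < y) => ?_
  simp only [Pi.mul_apply]
  rw [← ENNReal.ofReal_mul (by positivity), ← ENNReal.ofReal_mul (by positivity)]
  congr 1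
  rw [show α + c - 1 = (α - 1) + c by ring, Real.rpow_add hy,
    show -(α + β + e) = -(α + β) + -e by ring, Real.rpow_add (by positivity : (0 : ℝ) < 1 + y)]
  field_simp

/-! ### Moments of the beta prime law and of its logarithm -/

lemma ae_nonneg_rpow_mul_betaPrimeMeasure (α β c e : ℝ) :
    0 ≤ᵐ[betaPrimeMeasure α β] fun y => y ^ c * (1 + y) ^ (-e) := by
  filter_upwards [ae_pos_betaPrimeMeasure α β] with y hy
  positivity

lemma integral_rpow_mul_betaPrimeMeasure {α β c e : ℝ} (hα : 0 < α) (hβ : 0 < β)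
    (hc : 0 < α + c) (he : 0 < β - c + e) :
    ∫ y, y ^ c * (1 + y) ^ (-e) ∂(betaPrimeMeasure α β) =
      Real.Gamma (α + β) / (Real.Gamma α * Real.Gamma β) *
        (Real.Gamma (α + c) * Real.Gamma (β - c + e) / Real.Gamma (α + β + e)) := by
  have hΓα := Real.Gamma_pos_of_pos hα
  have hΓβ := Real.Gamma_pos_of_pos hβ
  have hΓαβ := Real.Gamma_pos_of_pos (add_pos hα hβ)
  have hΓ1 := Real.Gamma_pos_of_pos hc
  have hΓ2 := Real.Gamma_pos_of_pos he
  have hΓ3 := Real.Gamma_pos_of_pos (show 0 < α + β + e by linarith)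
  rw [integral_eq_lintegral_of_nonneg_ae (ae_nonneg_rpow_mul_betaPrimeMeasure α β c e)
    (by fun_prop), lintegral_rpow_mul_betaPrimeMeasure hα hβ hc he, ENNReal.toReal_ofReal]
  positivity

lemma integrable_rpow_mul_betaPrimeMeasure {α β c e : ℝ} (hα : 0 < α) (hβ : 0 < β)
    (hc : 0 < α + c) (he : 0 < β - c + e) :
    Integrable (fun y => y ^ c * (1 + y) ^ (-e)) (betaPrimeMeasure α β) := by
  refine ⟨by fun_prop, ?_⟩
  rw [hasFiniteIntegral_iff_ofReal (ae_nonneg_rpow_mul_betaPrimeMeasure α β c e),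
    lintegral_rpow_mul_betaPrimeMeasure hα hβ hc he]
  exact ENNReal.ofReal_lt_top

lemma integrable_pow_betaPrimeMeasure {α β : ℝ} {i : ℕ} (hα : 0 < α) (hi : (i : ℝ) < β) :
    Integrable (fun y => y ^ i) (betaPrimeMeasure α β) := by
  have hβ : 0 < β := (Nat.cast_nonneg i).trans_lt hi
  simpa using integrable_rpow_mul_betaPrimeMeasure (c := i) (e := 0) hα hβ (by positivity)
    (by linarith)

lemma integral_pow_betaPrimeMeasure {α β : ℝ} {i : ℕ} (hα : 0 < α) (hi : (i : ℝ) < β) :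
    ∫ y, y ^ i ∂(betaPrimeMeasure α β) =
      ∏ l ∈ Finset.Icc 1 i, (α + (l : ℝ) - 1) / (β - (l : ℝ)) := by
  have hβ : 0 < β := (Nat.cast_nonneg i).trans_lt hi
  have h := integral_rpow_mul_betaPrimeMeasure (c := i) (e := 0) hα hβ (by positivity)
    (by linarith)
  simp only [Real.rpow_natCast, neg_zero, Real.rpow_zero, mul_one, add_zero] at h
  rw [h]
  have hΓα := Real.Gamma_pos_of_pos hα
  have hΓβ := Real.Gamma_pos_of_pos hβ
  have hΓαβ := Real.Gamma_pos_of_pos (add_pos hα hβ)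
  clear h
  induction i with
  | zero => simp; field_simp
  | succ i ih =>
    push_cast at hi
    rw [Finset.prod_Icc_succ_top (by lia), ← ih (by linarith)]
    have h1 : Real.Gamma (α + ((i + 1 : ℕ) : ℝ)) = (α + i) * Real.Gamma (α + i) := by
      rw [← Real.Gamma_add_one (by positivity)]
      push_cast
      ring_nf
    have h2 : Real.Gamma (β - i) = (β - (i + 1)) * Real.Gamma (β - ((i + 1 : ℕ) : ℝ)) := by
      have : β - i = (β - (i + 1)) + 1 := by ring
      rw [this, Real.Gamma_add_one (by linarith)]
      push_cast
      ring_nf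
    have h3 : β - (i + 1) ≠ 0 := by linarith
    rw [h1, h2]
    push_cast
    rw [show α + ((i : ℝ) + 1) - 1 = α + i by ring]
    field_simp

/-- The moments of the beta prime law with parameters `1/2` and `ν₂/2` are the `b N i`. -/
lemma integral_pow_betaPrimeMeasure_half {N i : ℕ} (hi : 2 * (i : ℝ) < nu₂ N) :
    ∫ y, y ^ i ∂(betaPrimeMeasure (1 / 2) (nu₂ N / 2)) = b N i := by
  rw [integral_pow_betaPrimeMeasure (by norm_num) (by linarith), b]
  refine Finset.prod_congr rfl fun l hl => ?_
  have hl' : (l : ℝ) ≤ i := by exact_mod_cast (Finset.mem_Icc.mp hl).2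
  have h1 : nu₂ N - 2 * l ≠ 0 := by linarith
  have h2 : nu₂ N / 2 - l ≠ 0 := by linarith
  field_simp
  ring

lemma exp_mul_log_one_add_ae (α β t : ℝ) :
    (fun y => Real.exp (t * Real.log (1 + y))) =ᵐ[betaPrimeMeasure α β]
      fun y => y ^ (0 : ℝ) * (1 + y) ^ (-(-t)) := by
  filter_upwards [ae_pos_betaPrimeMeasure α β] with y hy
  rw [Real.rpow_zero, one_mul, neg_neg, Real.rpow_def_of_pos (by linarith), mul_comm]

lemma Iio_subset_integrableExpSet_log_one_add {α β : ℝ} (hα : 0 < α) (hβ : 0 < β) :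
    Iio β ⊆ integrableExpSet (fun y => Real.log (1 + y)) (betaPrimeMeasure α β) := by
  intro t (ht : t < β)
  exact (integrable_congr (exp_mul_log_one_add_ae α β t)).mpr
    (integrable_rpow_mul_betaPrimeMeasure hα hβ (by linarith) (by linarith))

lemma zero_mem_interior_integrableExpSet_log_one_add {α β : ℝ} (hα : 0 < α) (hβ : 0 < β) :
    0 ∈ interior (integrableExpSet (fun y => Real.log (1 + y)) (betaPrimeMeasure α β)) :=
  interior_maximal (Iio_subset_integrableExpSet_log_one_add hα hβ) isOpen_Iio hβ

lemma memLp_log_one_add_betaPrimeMeasure {α β : ℝ} (hα : 0 < α) (hβ : 0 < β) (q : NNReal) :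
    MemLp (fun y => Real.log (1 + y)) q (betaPrimeMeasure α β) :=
  memLp_of_mem_interior_integrableExpSet (zero_mem_interior_integrableExpSet_log_one_add hα hβ) q

lemma cgf_log_one_add_betaPrimeMeasure {α β t : ℝ} (hα : 0 < α) (ht : t < β) (hβ : 0 < β) :
    cgf (fun y => Real.log (1 + y)) (betaPrimeMeasure α β) t =
      Real.log (Real.Gamma (α + β) / Real.Gamma β) +
        (Real.log (Real.Gamma (β - t)) - Real.log (Real.Gamma (α + β - t))) := by
  have hΓα := Real.Gamma_pos_of_pos hα
  have hΓβ := Real.Gamma_pos_of_pos hβ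
  have hΓαβ := Real.Gamma_pos_of_pos (add_pos hα hβ)
  have hΓ1 := Real.Gamma_pos_of_pos (sub_pos.mpr ht)
  have hΓ2 := Real.Gamma_pos_of_pos (show 0 < α + β - t by linarith)
  rw [cgf, mgf, integral_congr_ae (exp_mul_log_one_add_ae α β t),
    integral_rpow_mul_betaPrimeMeasure hα hβ (by linarith) (by linarith),
    ← Real.log_div hΓ1.ne' hΓ2.ne', ← Real.log_mul (by positivity) (by positivity)]
  congr 1
  simp only [add_zero, sub_zero, ← sub_eq_add_neg]
  field_simp

lemma hasDerivAt_log_Gamma {x : ℝ} (hx : 0 < x) :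
    HasDerivAt (fun y => Real.log (Real.Gamma y)) (digamma x) x :=
  (Real.differentiableAt_Gamma fun m h => by
    have : (0 : ℝ) ≤ m := m.cast_nonneg
    linarith).hasDerivAt.log (Real.Gamma_pos_of_pos hx).ne'

/-- The cumulant generating function of `log (1 + y)` has derivative `t ↦ D (ν - 2 t)` below
`ν / 2`, so that its values and derivatives at `0` are those of `D` at `ν`. -/
lemma deriv_cgf_log_one_add {ν t : ℝ} (hν : 0 < ν) (ht : t < ν / 2) :
    deriv (cgf (fun y => Real.log (1 + y)) (betaPrimeMeasure (1 / 2) (ν / 2))) t =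
      D (ν - 2 * t) := by
  have hev : cgf (fun y => Real.log (1 + y)) (betaPrimeMeasure (1 / 2) (ν / 2)) =ᶠ[𝓝 t]
      fun s => Real.log (Real.Gamma (1 / 2 + ν / 2) / Real.Gamma (ν / 2)) +
        (Real.log (Real.Gamma (ν / 2 - s)) - Real.log (Real.Gamma (1 / 2 + ν / 2 - s))) := by
    filter_upwards [Iio_mem_nhds ht] with s hs
    exact cgf_log_one_add_betaPrimeMeasure (by norm_num) hs (by positivity)
  rw [hev.deriv_eq]
  have h1 := (hasDerivAt_log_Gamma (sub_pos.mpr ht)).comp_const_sub (ν / 2) t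
  have h2 := (hasDerivAt_log_Gamma
    (show 0 < 1 / 2 + ν / 2 - t by linarith)).comp_const_sub (1 / 2 + ν / 2) t
  refine ((h1.sub h2).const_add _).deriv.trans ?_
  rw [D]
  ring_nf

lemma integral_log_one_add_betaPrimeMeasure {ν : ℝ} (hν : 0 < ν) :
    ∫ y, Real.log (1 + y) ∂(betaPrimeMeasure (1 / 2) (ν / 2)) = D ν := by
  have := isProbabilityMeasure_betaPrimeMeasure (α := 1 / 2) (β := ν / 2) (by norm_num)
    (by positivity)
  have h := deriv_cgf_zero (zero_mem_interior_integrableExpSet_log_one_add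
    (α := 1 / 2) (β := ν / 2) (by norm_num) (by positivity))
  rw [deriv_cgf_log_one_add hν (by positivity), probReal_univ, div_one, mul_zero, sub_zero] at h
  exact h.symm

lemma variance_log_one_add_betaPrimeMeasure {ν : ℝ} (hν : 0 < ν) :
    Var[fun y => Real.log (1 + y); betaPrimeMeasure (1 / 2) (ν / 2)] = -2 * deriv D ν := by
  have := isProbabilityMeasure_betaPrimeMeasure (α := 1 / 2) (β := ν / 2) (by norm_num)
    (by positivity)
  have h0 := zero_mem_interior_integrableExpSet_log_one_add
    (α := 1 / 2) (β := ν / 2) (by norm_num) (by positivity)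
  have hd : deriv (cgf (fun y => Real.log (1 + y)) (betaPrimeMeasure (1 / 2) (ν / 2))) =ᶠ[𝓝 0]
      fun t => D (ν - 2 * t) := by
    filter_upwards [Iio_mem_nhds (show 0 < ν / 2 by positivity)] with t ht
    exact deriv_cgf_log_one_add hν ht
  have h := iteratedDeriv_two_cgf h0
  rw [iteratedDeriv_succ, iteratedDeriv_one, hd.deriv_eq,
    deriv_comp_mul_left (2 : ℝ) (fun x => D (ν - x)) 0, deriv_comp_const_sub,
    deriv_cgf_log_one_add hν (by positivity)] at h
  rw [variance_eq_sub (memLp_log_one_add_betaPrimeMeasure (by norm_num) (by positivity) 2),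
    integral_log_one_add_betaPrimeMeasure hν]
  simp only [zero_mul, Real.exp_zero, mul_one, mul_zero, sub_zero, mgf_zero, div_one, smul_eq_mul] at h
  simp only [Pi.pow_apply]
  linarith

lemma variance_log_one_add_betaPrimeMeasure_pos {α β : ℝ} (hα : 0 < α) (hβ : 0 < β) :
    0 < Var[fun y => Real.log (1 + y); betaPrimeMeasure α β] := by
  have := isProbabilityMeasure_betaPrimeMeasure hα hβ
  refine (variance_nonneg _ _).lt_of_ne' fun h => ?_
  have hc := ae_eq_integral_of_variance_eq_zero
    (memLp_log_one_add_betaPrimeMeasure hα hβ 2) h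
  set c := ∫ y, Real.log (1 + y) ∂(betaPrimeMeasure α β)
  -- a constant logarithm would put all the mass on one point
  have : ∀ᵐ y ∂(betaPrimeMeasure α β), False := by
    filter_upwards [hc, ae_pos_betaPrimeMeasure α β,
      compl_mem_ae_iff.mpr (measure_singleton (Real.exp c - 1))] with y h1 h2 h3
    apply h3
    rw [← h1, Real.exp_log (by linarith)]
    simp
  simp at this
  exact IsProbabilityMeasure.ne_zero _ this

/-! ### Sums of squares of standard normal variables -/

lemma lintegral_eq_two_mul_lintegral_Ioi_of_even {f : ℝ → ℝ≥0∞} (hf : ∀ x, f (-x) = f x) :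
    ∫⁻ x, f x = 2 * ∫⁻ x in Ioi 0, f x := by
  have h : ∫⁻ x in Iio 0, f x = ∫⁻ x in Ioi 0, f x := by
    have := (Measure.measurePreserving_neg (volume : Measure ℝ)).setLIntegral_comp_preimage_emb
      (MeasurableEquiv.neg ℝ).measurableEmbedding f (Iio 0)
    simpa [hf] using this.symm
  rw [← lintegral_add_compl f (measurableSet_Ioi (a := (0 : ℝ))), compl_Ioi,
    setLIntegral_congr Iio_ae_eq_Iic.symm, h, two_mul]

/-- The square of a standard normal variable has the gamma law of shape `1/2` and rate `1/2`. -/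
lemma map_sq_gaussianReal :
    (gaussianReal 0 1).map (fun x => x ^ 2) = gammaMeasure (1 / 2) (1 / 2) := by
  refine Measure.ext_of_lintegral _ fun f hf => ?_
  rw [lintegral_map hf (by fun_prop), lintegral_gammaMeasure hf,
    gaussianReal_of_var_ne_zero _ one_ne_zero,
    lintegral_withDensity_eq_lintegral_mul _ (by fun_prop) (by fun_prop),
    lintegral_eq_two_mul_lintegral_Ioi_of_even]
  swap
  · intro x; simp [gaussianPDF, gaussianPDFReal]
  have himg : (fun x : ℝ => x ^ 2) '' Ioi 0 = Ioi 0 := by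
    ext u
    constructor
    · rintro ⟨x, hx : 0 < x, rfl⟩
      exact pow_pos hx 2
    · intro (hu : 0 < u)
      exact ⟨√u, Real.sqrt_pos.mpr hu, Real.sq_sqrt hu.le⟩
  have hderiv : ∀ x ∈ Ioi (0 : ℝ), HasDerivWithinAt (fun x : ℝ => x ^ 2) (2 * x) (Ioi 0) x :=
    fun x _ => by simpa using (hasDerivAt_pow 2 x).hasDerivWithinAt
  have hinj : InjOn (fun x : ℝ => x ^ 2) (Ioi 0) := fun x (hx : 0 < x) y (hy : 0 < y) hxy =>
    (pow_left_inj₀ hx.le hy.le two_ne_zero).mp hxy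
  conv_rhs => rw [← himg, lintegral_image_eq_lintegral_abs_deriv_mul measurableSet_Ioi hderiv hinj]
  rw [← lintegral_const_mul _ (by fun_prop), ← lintegral_const_mul _ (by fun_prop)]
  refine setLIntegral_congr_fun measurableSet_Ioi fun x (hx : 0 < x) => ?_
  simp only [Pi.mul_apply, gaussianPDF, gaussianPDFReal]
  rw [← mul_assoc, ← mul_assoc, ← mul_assoc, abs_of_pos (by positivity),
    show (2 : ℝ≥0∞) = ENNReal.ofReal 2 by simp,
    ← ENNReal.ofReal_mul (by positivity), ← ENNReal.ofReal_mul (by positivity),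
    ← ENNReal.ofReal_mul (by positivity)]
  congr 2
  have h1 : (x ^ 2) ^ ((1 : ℝ) / 2 - 1) = x⁻¹ := by
    rw [← Real.rpow_natCast, ← Real.rpow_mul hx.le, ← Real.rpow_neg_one]
    norm_num
  have h2 : ((1 : ℝ) / 2) ^ ((1 : ℝ) / 2) = (√2)⁻¹ := by
    rw [← Real.sqrt_eq_rpow, Real.sqrt_div zero_le_one, Real.sqrt_one, one_div]
  rw [h1, h2, Real.Gamma_one_half_eq, NNReal.coe_one, mul_one, Real.sqrt_mul zero_le_two]
  simp only [sub_zero, mul_one]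
  field_simp

/-- The sum of the squares of `n ≥ 1` independent standard normal variables has the gamma law of
shape `n / 2` and rate `1 / 2` (the chi-square law with `n` degrees of freedom). -/
lemma map_sum_sq_pi_gaussianReal {n : ℕ} (hn : n ≠ 0) :
    (Measure.pi fun _ : Fin n => gaussianReal 0 1).map (fun w => ∑ k, w k ^ 2) =
      gammaMeasure (n / 2) (1 / 2) := by
  induction n, Nat.one_le_iff_ne_zero.mpr hn using Nat.le_induction with
  | base =>
    have h : (fun w : Fin 1 → ℝ => ∑ k, w k ^ 2) = (fun x : ℝ => x ^ 2) ∘ Function.eval 0 := by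
      ext; simp
    rw [h, ← Measure.map_map (by fun_prop) (by fun_prop),
      (measurePreserving_eval (fun _ : Fin 1 => gaussianReal 0 1) 0).map_eq, map_sq_gaussianReal]
    norm_num
  | succ n hn' ih =>
    have hn0 : (0 : ℝ) < n := by exact_mod_cast hn'
    have hsplit := (measurePreserving_piFinSuccAbove
      (fun _ : Fin (n + 1) => gaussianReal 0 1) 0).map_eq
    have h : (fun w : Fin (n + 1) → ℝ => ∑ k, w k ^ 2) = (fun q : ℝ × ℝ => q.1 + q.2) ∘
        (Prod.map (fun x : ℝ => x ^ 2) (fun w : Fin n → ℝ => ∑ k, w k ^ 2)) ∘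
          (MeasurableEquiv.piFinSuccAbove (fun _ : Fin (n + 1) => ℝ) 0) := by
      ext w
      simp [Fin.sum_univ_succ, MeasurableEquiv.piFinSuccAbove, Fin.insertNthEquiv, Fin.tail]
    rw [h, ← Measure.map_map (by fun_prop) (by fun_prop),
      ← Measure.map_map (by fun_prop) (by fun_prop), hsplit,
      ← Measure.map_prod_map _ _ (by fun_prop) (by fun_prop), map_sq_gaussianReal, ih (by lia),
      map_add_gammaMeasure_prod (by norm_num) (by positivity) (by norm_num)]
    push_cast
    ring_nf

lemma map_sq_div_sum_sq_pi_gaussianReal {n : ℕ} (hn : n ≠ 0) :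
    (Measure.pi fun _ : Fin 2 ⊕ Fin n => gaussianReal 0 1).map
        (fun w => w (.inl 0) ^ 2 / ∑ k, w (.inr k) ^ 2) =
      betaPrimeMeasure (1 / 2) (n / 2) := by
  have hn0 : (0 : ℝ) < n := by exact_mod_cast Nat.pos_of_ne_zero hn
  have hsplit := (measurePreserving_sumPiEquivProdPi
    (fun _ : Fin 2 ⊕ Fin n => gaussianReal 0 1)).map_eq
  have h : (fun w : Fin 2 ⊕ Fin n → ℝ => w (.inl 0) ^ 2 / ∑ k, w (.inr k) ^ 2) =
      (fun q : ℝ × ℝ => q.1 / q.2) ∘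
        (Prod.map ((fun x : ℝ => x ^ 2) ∘ Function.eval 0) (fun w : Fin n → ℝ => ∑ k, w k ^ 2)) ∘
          (MeasurableEquiv.sumPiEquivProdPi (fun _ : Fin 2 ⊕ Fin n => ℝ)) := by
    ext w
    rfl
  rw [h, ← Measure.map_map (by fun_prop) (by fun_prop),
    ← Measure.map_map (by fun_prop) (by fun_prop), hsplit,
    ← Measure.map_prod_map _ _ (by fun_prop) (by fun_prop),
    ← Measure.map_map (by fun_prop) (by fun_prop),
    (measurePreserving_eval (fun _ : Fin 2 => gaussianReal 0 1) 0).map_eq, map_sq_gaussianReal,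
    map_sum_sq_pi_gaussianReal hn,
    map_div_gammaMeasure_prod (by norm_num) (by positivity) (by norm_num)]

/-! ### The law of a squared two-sample t-statistic -/

section

/-- Expanding a standard normal vector in any orthonormal basis gives standard normal coordinates. -/
lemma map_inner_orthonormalBasis_pi_gaussianReal {κ ι : Type*} [Fintype κ] [Fintype ι]
    (e : OrthonormalBasis ι ℝ (EuclideanSpace ℝ κ)) :
    (Measure.pi fun _ : κ => gaussianReal 0 1).map (fun z i => ⟪e i, WithLp.toLp 2 z⟫) =
      Measure.pi fun _ : ι => gaussianReal 0 1 := by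
  have h1 : (fun (z : κ → ℝ) i => ⟪e i, WithLp.toLp 2 z⟫) =
      WithLp.ofLp ∘ e.repr ∘ WithLp.toLp 2 := by
    ext z i
    simp [e.repr_apply_apply]
  have hm : Measurable (e.repr : EuclideanSpace ℝ κ → EuclideanSpace ℝ ι) :=
    e.repr.continuous.measurable
  rw [h1, ← Measure.map_map (by fun_prop) (by fun_prop), ← Measure.map_map hm (by fun_prop),
    map_pi_eq_stdGaussian, stdGaussian_map, ← map_pi_eq_stdGaussian,
    Measure.map_map (by fun_prop) (by fun_prop)]
  exact Measure.map_id

variable {n₁ n₂ : ℕ}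

/-- The statistic `t² / ν₂` of one coordinate, as a function of the pooled vector of the
observations of that coordinate: between-sample over within-sample sum of squares. -/
def ratioStat (z : Fin n₁ ⊕ Fin n₂ → ℝ) : ℝ :=
  (n₁ * n₂ / (n₁ + n₂) : ℝ) * ((∑ i, z (.inl i)) / n₁ - (∑ i, z (.inr i)) / n₂) ^ 2 /
    (∑ i, (z (.inl i) - (∑ i, z (.inl i)) / n₁) ^ 2 +
      ∑ i, (z (.inr i) - (∑ i, z (.inr i)) / n₂) ^ 2)

lemma measurable_ratioStat : Measurable (ratioStat (n₁ := n₁) (n₂ := n₂)) := by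
  unfold ratioStat
  fun_prop

lemma ratioStat_affine (hn₁ : n₁ ≠ 0) (hn₂ : n₂ ≠ 0) {σ : ℝ} (hσ : σ ≠ 0) (μ : ℝ)
    (z : Fin n₁ ⊕ Fin n₂ → ℝ) : ratioStat (fun i => σ * z i + μ) = ratioStat z := by
  have h1 : (n₁ : ℝ) ≠ 0 := by exact_mod_cast hn₁
  have h2 : (n₂ : ℝ) ≠ 0 := by exact_mod_cast hn₂
  have hmean {n : ℕ} (hn : (n : ℝ) ≠ 0) (x : Fin n → ℝ) :
      (∑ i, (σ * x i + μ)) / n = σ * ((∑ i, x i) / n) + μ := by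
    rw [Finset.sum_add_distrib, ← Finset.mul_sum]
    simp
    field_simp
  unfold ratioStat
  rw [hmean h1 fun i => z (.inl i), hmean h2 fun i => z (.inr i)]
  simp only [add_sub_add_right_eq_sub, ← mul_sub, mul_pow, ← Finset.mul_sum, ← mul_add]
  rw [mul_left_comm, mul_div_mul_left _ _ (pow_ne_zero 2 hσ)]

lemma sum_sub_mean_sq {n : ℕ} (hn : n ≠ 0) (x : Fin n → ℝ) :
    ∑ i, (x i - (∑ i, x i) / n) ^ 2 = ∑ i, x i ^ 2 - (∑ i, x i) ^ 2 / n := by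
  have h : (n : ℝ) ≠ 0 := by exact_mod_cast hn
  simp only [sub_sq, Finset.sum_add_distrib, Finset.sum_sub_distrib, ← Finset.mul_sum,
    ← Finset.sum_mul]
  simp
  field_simp
  ring

/-- The ratio statistic in an orthonormal basis whose first two vectors are the normalized contrast
of the two samples and the normalized constant vector: the within-sample sum of squares is the
squared length of the projection to the remaining vectors. -/
lemma exists_orthonormalBasis_ratioStat_eq (hn₁ : n₁ ≠ 0) (hn₂ : n₂ ≠ 0) :
    ∃ e : OrthonormalBasis (Fin 2 ⊕ Fin (n₁ + n₂ - 2)) ℝ (EuclideanSpace ℝ (Fin n₁ ⊕ Fin n₂)),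
      ∀ z : Fin n₁ ⊕ Fin n₂ → ℝ, ratioStat z =
        ⟪e (.inl 0), WithLp.toLp 2 z⟫ ^ 2 / ∑ k, ⟪e (.inr k), WithLp.toLp 2 z⟫ ^ 2 := by
  have h1 : (0 : ℝ) < n₁ := by exact_mod_cast Nat.pos_of_ne_zero hn₁
  have h2 : (0 : ℝ) < n₂ := by exact_mod_cast Nat.pos_of_ne_zero hn₂
  set c : ℝ := √(n₁ * n₂ / (n₁ + n₂)) with hc
  set d : ℝ := (√(n₁ + n₂))⁻¹ with hd
  have hc2 : c ^ 2 = n₁ * n₂ / (n₁ + n₂) := Real.sq_sqrt (by positivity)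
  have hd2 : d ^ 2 = (n₁ + n₂ : ℝ)⁻¹ := by rw [hd, inv_pow, Real.sq_sqrt (by positivity)]
  let v : Fin 2 ⊕ Fin (n₁ + n₂ - 2) → EuclideanSpace ℝ (Fin n₁ ⊕ Fin n₂) := fun i =>
    WithLp.toLp 2 (if i = .inl 0 then Sum.elim (fun _ => c / n₁) (fun _ => -c / n₂)
      else fun _ => d)
  have hv : Orthonormal ℝ ((range Sum.inl).domRestrict v) := by
    rw [orthonormal_iff_ite]
    rintro ⟨_, i, rfl⟩ ⟨_, j, rfl⟩
    fin_cases i <;> fin_cases j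
    · change ⟪v (.inl 0), v (.inl 0)⟫ = _
      rw [real_inner_self_eq_norm_sq, EuclideanSpace.real_norm_sq_eq]
      simp [v]
      field_simp
      rw [hc2]
      field_simp
      ring
    · simp [v, PiLp.inner_apply]
      field_simp
      ring
    · simp [v, PiLp.inner_apply]
      field_simp
      ring
    · change ⟪v (.inl 1), v (.inl 1)⟫ = _
      rw [real_inner_self_eq_norm_sq, EuclideanSpace.real_norm_sq_eq]
      simp [v]
      rw [hd2]
      field_simp
  obtain ⟨e, he⟩ := hv.exists_orthonormalBasis_extension_of_card_eq (by simp; lia)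
  refine ⟨e, fun z => ?_⟩
  have h0 : ⟪e (.inl 0), WithLp.toLp 2 z⟫ =
      c * ((∑ i, z (.inl i)) / n₁ - (∑ i, z (.inr i)) / n₂) := by
    rw [he _ ⟨0, rfl⟩]
    simp [v, PiLp.inner_apply, ← Finset.sum_mul]
    ring
  have h1' : ⟪e (.inl 1), WithLp.toLp 2 z⟫ =
      d * (∑ i, z (.inl i) + ∑ i, z (.inr i)) := by
    rw [he _ ⟨1, rfl⟩]
    simp [v, PiLp.inner_apply, ← Finset.sum_mul]
    ring
  have hpars : ∑ i, ⟪e i, WithLp.toLp 2 z⟫ ^ 2 = ∑ i, z (.inl i) ^ 2 + ∑ i, z (.inr i) ^ 2 := by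
    have := e.sum_sq_norm_inner_right (WithLp.toLp 2 z)
    rw [EuclideanSpace.real_norm_sq_eq] at this
    simpa using this
  rw [Fintype.sum_sum_type, Fin.sum_univ_two, h0, h1'] at hpars
  rw [h0, ratioStat, sum_sub_mean_sq hn₁ fun i => z (.inl i),
    sum_sub_mean_sq hn₂ fun i => z (.inr i), mul_pow, hc2]
  congr 1
  simp only [mul_pow, hc2, hd2] at hpars
  have : ∑ k, ⟪e (.inr k), WithLp.toLp 2 z⟫ ^ 2 = ∑ i, z (.inl i) ^ 2 + ∑ i, z (.inr i) ^ 2 -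
      (n₁ * n₂ / (n₁ + n₂) * ((∑ i, z (.inl i)) / n₁ - (∑ i, z (.inr i)) / n₂) ^ 2 +
        (n₁ + n₂ : ℝ)⁻¹ * (∑ i, z (.inl i) + ∑ i, z (.inr i)) ^ 2) := by
    linarith
  rw [this]
  field_simp
  ring

/-- Under a common normal law of all observations, `t² / ν₂` has a beta prime law. -/
lemma map_ratioStat_pi_gaussianReal (hn₁ : n₁ ≠ 0) (hn₂ : n₂ ≠ 0) (hN : 3 ≤ n₁ + n₂) (μ : ℝ)
    {v : NNReal} (hv : v ≠ 0) :
    (Measure.pi fun _ : Fin n₁ ⊕ Fin n₂ => gaussianReal μ v).map ratioStat =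
      betaPrimeMeasure (1 / 2) (nu₂ (n₁ + n₂) / 2) := by
  obtain ⟨e, he⟩ := exists_orthonormalBasis_ratioStat_eq hn₁ hn₂
  have hσ : √(v : ℝ) ≠ 0 := (Real.sqrt_pos.mpr (by positivity)).ne'
  have hstd : (Measure.pi fun _ : Fin n₁ ⊕ Fin n₂ => gaussianReal μ v) =
      (Measure.pi fun _ : Fin n₁ ⊕ Fin n₂ => gaussianReal 0 1).map
        (fun z i => √(v : ℝ) * z i + μ) := by
    have h1 : (gaussianReal 0 1).map (fun x => √(v : ℝ) * x + μ) = gaussianReal μ v := by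
      have : (fun x => √(v : ℝ) * x + μ) = (fun x => x + μ) ∘ (fun x => √(v : ℝ) * x) := rfl
      rw [this, ← Measure.map_map (by fun_prop) (by fun_prop), gaussianReal_map_const_mul,
        gaussianReal_map_add_const]
      congr 1
      · simp
      · ext
        simp
    have := Measure.pi_map_pi (μ := fun _ : Fin n₁ ⊕ Fin n₂ => gaussianReal 0 1)
      (f := fun _ x => √(v : ℝ) * x + μ)
      (hμ := fun _ => by rw [h1]; infer_instance) (fun _ => by fun_prop)
    rw [this]
    simp only [h1]
  have hcomp : ratioStat ∘ (fun (z : Fin n₁ ⊕ Fin n₂ → ℝ) i => √(v : ℝ) * z i + μ) =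
      (fun w : Fin 2 ⊕ Fin (n₁ + n₂ - 2) → ℝ => w (.inl 0) ^ 2 / ∑ k, w (.inr k) ^ 2) ∘
        (fun z i => ⟪e i, WithLp.toLp 2 z⟫) := by
    ext z
    simp only [Function.comp_apply]
    rw [ratioStat_affine hn₁ hn₂ hσ, he]
  rw [hstd, Measure.map_map measurable_ratioStat (by fun_prop), hcomp,
    ← Measure.map_map (by fun_prop) (by fun_prop), map_inner_orthonormalBasis_pi_gaussianReal,
    map_sq_div_sum_sq_pi_gaussianReal (by lia), Nat.cast_sub (by lia), nu₂]
  norm_num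

/-- The two expressions agree also when the within-sample sum of squares vanishes: both are then
`0` by the convention for division by zero. -/
lemma tStat_sq_div_nu₂ {p : ℕ} (hN : 3 ≤ n₁ + n₂) (x : Fin n₁ → EuclideanSpace ℝ (Fin p))
    (y : Fin n₂ → EuclideanSpace ℝ (Fin p)) (j : Fin p) :
    tStat x y j ^ 2 / nu₂ (n₁ + n₂) = ratioStat (Sum.elim (fun i => x i j) (fun i => y i j)) := by
  have hν : 0 < nu₂ (n₁ + n₂) := by
    have : (3 : ℝ) ≤ (n₁ + n₂ : ℕ) := by exact_mod_cast hN
    unfold nu₂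
    linarith
  have hS : 0 ≤ pooledCov x y j j := by
    simp only [pooledCov, Matrix.of_apply, ← sq]
    positivity
  rw [tStat, div_pow, mul_pow, Real.sq_sqrt (by positivity), Real.sq_sqrt hS, ratioStat, div_div]
  simp only [pooledCov, Matrix.of_apply, ← sq, sampleMean, Sum.elim_inl, Sum.elim_inr]
  rw [div_mul_cancel₀ _ hν.ne']
  push_cast
  rfl

end

/-! ### Independence over the coordinates -/

section

lemma hasGaussianLaw_of_hasLaw_multivariateGaussian {Ω ι : Type*} [Fintype ι] [DecidableEq ι]
    [MeasurableSpace Ω] {P : Measure Ω} {W : Ω → EuclideanSpace ℝ ι} {μ : EuclideanSpace ℝ ι}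
    {S : Matrix ι ι ℝ} (hW : HasLaw W (multivariateGaussian μ S) P) : HasGaussianLaw W P :=
  ⟨by rw [hW.map_eq]; infer_instance⟩

/-- For independent normal vectors with a common diagonal covariance matrix, the vectors of all
observations of the `j`-th coordinates are independent over `j`: they are jointly Gaussian and
uncorrelated. -/
lemma iIndepFun_coordinates {Ω ι κ : Type*} [Fintype ι] [Fintype κ] [DecidableEq κ]
    [MeasurableSpace Ω] {P : Measure Ω} {Z : ι → Ω → EuclideanSpace ℝ κ}
    {μ : EuclideanSpace ℝ κ} {S : Matrix κ κ ℝ} (hS : S.PosSemidef) (hd : S.IsDiag)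
    (hZ : ∀ i, HasLaw (Z i) (multivariateGaussian μ S) P) (hind : iIndepFun Z P) :
    iIndepFun (fun j ω i => Z i ω j) P := by
  have hP := hind.isProbabilityMeasure
  have hG (i : ι) := hasGaussianLaw_of_hasLaw_multivariateGaussian (hZ i)
  have hjoint : HasGaussianLaw (fun ω i => Z i ω) P := iIndepFun.hasGaussianLaw hG hind
  have hm (i : ι) : AEMeasurable (Z i) P := (hZ i).aemeasurable
  refine HasGaussianLaw.iIndepFun_of_covariance_eval (X := fun j i ω => Z i ω j) ?_ ?_
  · let L : (ι → EuclideanSpace ℝ κ) →L[ℝ] (κ → ι → ℝ) :=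
      ContinuousLinearMap.pi fun j => ContinuousLinearMap.pi fun i =>
        (EuclideanSpace.proj j).comp (ContinuousLinearMap.proj i)
    exact hjoint.map L
  · intro j j' hj i i'
    by_cases hi : i = i'
    · subst hi
      have h := covariance_eval_multivariateGaussian (μ := μ) hS j j'
      rw [hd hj, ← (hZ i).map_eq, covariance_map (by fun_prop) (by fun_prop) (hm i)] at h
      exact h
    · have h := (hind.indepFun hi).comp (φ := fun x : EuclideanSpace ℝ κ => x j)
        (ψ := fun x : EuclideanSpace ℝ κ => x j') (by fun_prop) (by fun_prop)
      refine h.covariance_eq_zero ?_ ?_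
      · exact ((hG i).map (EuclideanSpace.proj (𝕜 := ℝ) j)).memLp_two
      · exact ((hG i').map (EuclideanSpace.proj (𝕜 := ℝ) j')).memLp_two

lemma hasLaw_coordinate {Ω ι κ : Type*} [Fintype ι] [Fintype κ] [DecidableEq κ]
    [MeasurableSpace Ω] {P : Measure Ω} {Z : ι → Ω → EuclideanSpace ℝ κ}
    {μ : EuclideanSpace ℝ κ} {S : Matrix κ κ ℝ} (hS : S.PosSemidef)
    (hZ : ∀ i, HasLaw (Z i) (multivariateGaussian μ S) P) (hind : iIndepFun Z P) (j : κ) :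
    HasLaw (fun ω i => Z i ω j) (Measure.pi fun _ : ι => gaussianReal (μ j) (S j j).toNNReal) P := by
  have hP := hind.isProbabilityMeasure
  have hm (i : ι) : AEMeasurable (Z i) P := (hZ i).aemeasurable
  have hlaw (i : ι) : HasLaw (fun ω => Z i ω j) (gaussianReal (μ j) (S j j).toNNReal) P :=
    (measurePreserving_eval_multivariateGaussian hS).comp_hasLaw (hZ i)
  refine ⟨aemeasurable_pi_lambda _ fun i => (hlaw i).aemeasurable, ?_⟩
  have h : iIndepFun (fun i ω => Z i ω j) P :=
    hind.comp (fun _ (x : EuclideanSpace ℝ κ) => x j) (fun _ => by fun_prop)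
  rw [iIndepFun_iff_map_fun_eq_pi_map fun i => (hlaw i).aemeasurable] at h
  refine h.trans ?_
  congr 1
  ext1 i
  exact (hlaw i).map_eq

variable {n₁ n₂ p : ℕ}

/-- The summand `N log (1 + t_{Nj}² / ν₂)` of `T₂`. -/
def logTerm (x : Fin n₁ → EuclideanSpace ℝ (Fin p)) (y : Fin n₂ → EuclideanSpace ℝ (Fin p))
    (j : Fin p) : ℝ :=
  ((n₁ + n₂ : ℕ) : ℝ) * Real.log (1 + tStat x y j ^ 2 / nu₂ (n₁ + n₂))

/-- The law of a summand of `T₂` under the null hypothesis, for total sample size `N`. -/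
def logTermLaw (N : ℕ) : Measure ℝ :=
  (betaPrimeMeasure (1 / 2) (nu₂ N / 2)).map fun y => (N : ℝ) * Real.log (1 + y)

lemma T₂_eq_sum_logTerm (x : Fin n₁ → EuclideanSpace ℝ (Fin p))
    (y : Fin n₂ → EuclideanSpace ℝ (Fin p)) : T₂ x y = ∑ j, logTerm x y j := by
  simp only [T₂, logTerm, Finset.mul_sum]

/-- Under the null hypothesis the summands of `T₂` are independent and identically distributed. -/
lemma iIndepFun_logTerm_and_hasLaw {Ω : Type*} [MeasurableSpace Ω] {P : Measure Ω}
    (hn₁ : n₁ ≠ 0) (hn₂ : n₂ ≠ 0) (hN : 3 ≤ n₁ + n₂)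
    {μ : EuclideanSpace ℝ (Fin p)} {S : Matrix (Fin p) (Fin p) ℝ} (hS : S.PosDef) (hd : S.IsDiag)
    {X : Fin n₁ → Ω → EuclideanSpace ℝ (Fin p)} {Y : Fin n₂ → Ω → EuclideanSpace ℝ (Fin p)}
    (hX : ∀ i, HasLaw (X i) (multivariateGaussian μ S) P)
    (hY : ∀ i, HasLaw (Y i) (multivariateGaussian μ S) P)
    (hXY : iIndepFun (Sum.elim X Y) P) :
    iIndepFun (fun j ω => logTerm (fun i => X i ω) (fun i => Y i ω) j) P ∧
      ∀ j, HasLaw (fun ω => logTerm (fun i => X i ω) (fun i => Y i ω) j)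
        (logTermLaw (n₁ + n₂)) P := by
  have hZ (i : Fin n₁ ⊕ Fin n₂) : HasLaw (Sum.elim X Y i) (multivariateGaussian μ S) P := by
    rcases i with i | i
    · exact hX i
    · exact hY i
  have hf : Measurable fun y : ℝ => ((n₁ + n₂ : ℕ) : ℝ) * Real.log (1 + y) := by fun_prop
  have heq (j : Fin p) : (fun ω => logTerm (fun i => X i ω) (fun i => Y i ω) j) =
      ((fun y : ℝ => ((n₁ + n₂ : ℕ) : ℝ) * Real.log (1 + y)) ∘ ratioStat) ∘
        fun ω i => Sum.elim X Y i ω j := by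
    ext ω
    simp only [logTerm, tStat_sq_div_nu₂ hN, Function.comp_apply]
    congr 4
    ext i
    rcases i with i | i <;> rfl
  refine ⟨funext heq ▸ (iIndepFun_coordinates hS.posSemidef hd hZ hXY).comp _
    fun _ => hf.comp measurable_ratioStat, fun j => ?_⟩
  have h1 := hasLaw_coordinate hS.posSemidef hZ hXY j
  have h2 : HasLaw ratioStat (betaPrimeMeasure (1 / 2) (nu₂ (n₁ + n₂) / 2))
      (Measure.pi fun _ : Fin n₁ ⊕ Fin n₂ => gaussianReal (μ j) (S j j).toNNReal) :=
    ⟨measurable_ratioStat.aemeasurable,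
      map_ratioStat_pi_gaussianReal hn₁ hn₂ hN _ (Real.toNNReal_pos.mpr hS.diag_pos).ne'⟩
  have h3 : HasLaw (fun y : ℝ => ((n₁ + n₂ : ℕ) : ℝ) * Real.log (1 + y))
      (logTermLaw (n₁ + n₂)) (betaPrimeMeasure (1 / 2) (nu₂ (n₁ + n₂) / 2)) :=
    ⟨hf.aemeasurable, rfl⟩
  exact heq j ▸ (h3.comp h2).comp h1

end

/-! ### A central limit theorem for row-wise i.i.d. arrays -/

lemma norm_exp_mul_I_sub_taylor_two_le (x : ℝ) :
    ‖Complex.exp (x * Complex.I) - (1 + x * Complex.I - x ^ 2 / 2)‖ ≤ 4 * |x| ^ 3 := by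
  have hx : ‖(x : ℂ) * Complex.I‖ = |x| := by simp
  rcases le_total |x| 1 with h | h
  · have h1 := Complex.norm_exp_sub_sum_le_norm_mul_exp (x * Complex.I) 3
    have h2 : ∑ m ∈ Finset.range 3, ((x : ℂ) * Complex.I) ^ m / (m.factorial : ℂ) =
        1 + x * Complex.I - x ^ 2 / 2 := by
      simp [Finset.sum_range_succ, mul_pow, Nat.factorial]
      ring
    rw [h2, hx] at h1
    have h3 : Real.exp |x| ≤ 4 :=
      (Real.exp_le_exp.mpr h).trans (Real.exp_one_lt_d9.le.trans (by norm_num))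
    nlinarith [pow_nonneg (abs_nonneg x) 3]
  · have h1 : ‖Complex.exp (x * Complex.I) - (1 + x * Complex.I - x ^ 2 / 2)‖ ≤
        1 + (1 + |x| + |x| ^ 2 / 2) := by
      refine (norm_sub_le _ _).trans ?_
      rw [Complex.norm_exp_ofReal_mul_I]
      gcongr
      refine (norm_sub_le _ _).trans (add_le_add ((norm_add_le _ _).trans (by simp)) ?_)
      simp
    have h2 : |x| ≤ |x| ^ 3 := le_self_pow₀ h (by norm_num)
    have h3 : |x| ^ 2 ≤ |x| ^ 3 := pow_le_pow_right₀ h (by norm_num)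
    linarith

/-- A quantitative second-order expansion of the characteristic function of a centered law. -/
lemma norm_charFun_sub_le {ρ : Measure ℝ} [IsProbabilityMeasure ρ] (hρ : MemLp id 3 ρ)
    (h0 : ∫ x, x ∂ρ = 0) (s : ℝ) :
    ‖charFun ρ s - (1 - s ^ 2 * (∫ x, x ^ 2 ∂ρ : ℝ) / 2)‖ ≤ 4 * |s| ^ 3 * ∫ x, |x| ^ 3 ∂ρ := by
  have i1 : Integrable (fun x : ℝ => x) ρ := hρ.integrable (by norm_num)
  have i2 : Integrable (fun x : ℝ => x ^ 2) ρ := (hρ.mono_exponent (by norm_num)).integrable_sq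
  have i3 : Integrable (fun x : ℝ => |x| ^ 3) ρ := by
    simpa using hρ.integrable_norm_pow (by norm_num)
  have ie : Integrable (fun x : ℝ => Complex.exp (s * x * Complex.I)) ρ := by
    refine (integrable_const (1 : ℝ)).mono' (by fun_prop) (.of_forall fun x => ?_)
    rw [← Complex.ofReal_mul, Complex.norm_exp_ofReal_mul_I]
  have hT : ∫ x : ℝ, (1 + (s * x : ℝ) * Complex.I - ((s * x : ℝ) : ℂ) ^ 2 / 2) ∂ρ =
      (1 - s ^ 2 * (∫ x, x ^ 2 ∂ρ : ℝ) / 2 : ℂ) := by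
    have e : ∀ x : ℝ, (1 + (s * x : ℝ) * Complex.I - ((s * x : ℝ) : ℂ) ^ 2 / 2 : ℂ) =
        1 + (s * Complex.I) * (x : ℂ) - (s ^ 2 / 2) * ((x ^ 2 : ℝ) : ℂ) := by
      intro x; push_cast; ring
    simp only [e]
    rw [integral_sub ((integrable_const _).add (i1.ofReal.const_mul _)) (i2.ofReal.const_mul _),
      integral_add (integrable_const _) (i1.ofReal.const_mul _), integral_const_mul,
      integral_const_mul, integral_complex_ofReal, integral_complex_ofReal, h0]
    simp
    ring
  have iT : Integrable (fun x : ℝ => (1 + (s * x : ℝ) * Complex.I -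
      ((s * x : ℝ) : ℂ) ^ 2 / 2 : ℂ)) ρ := by
    have := ((integrable_const (1 : ℂ)).add (i1.ofReal.const_mul (s * Complex.I))).sub
      (i2.ofReal.const_mul (s ^ 2 / 2 : ℂ))
    refine this.congr (.of_forall fun x => ?_)
    simp
    ring
  rw [charFun_apply_real, ← hT, ← integral_sub ie iT, ← integral_const_mul]
  refine norm_integral_le_of_norm_le (i3.const_mul _) (.of_forall fun x => ?_)
  have := norm_exp_mul_I_sub_taylor_two_le (s * x)
  rw [abs_mul, mul_pow, ← mul_assoc] at this
  exact_mod_cast this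

lemma tendsto_pow_exp_of_tendsto_mul_sub_one {p : ℕ → ℕ} (hp : Tendsto p atTop atTop)
    {f : ℕ → ℂ} {c : ℂ} (hf : Tendsto (fun m => (p m : ℂ) * (f m - 1)) atTop (𝓝 c)) :
    Tendsto (fun m => f m ^ p m) atTop (𝓝 (Complex.exp c)) := by
  have hpinv : Tendsto (fun m => ((p m : ℂ))⁻¹) atTop (𝓝 0) :=
    (tendsto_inv_atTop_nhds_zero_nat (𝕜 := ℂ)).comp hp
  have hp0 : ∀ᶠ m in atTop, (p m : ℂ) ≠ 0 := by
    filter_upwards [hp.eventually_ge_atTop 1] with m hm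
    exact_mod_cast (by lia : p m ≠ 0)
  have hz : Tendsto (fun m => f m - 1) atTop (𝓝 0) := by
    have := hf.mul hpinv
    rw [mul_zero] at this
    refine this.congr' ?_
    filter_upwards [hp0] with m hm
    field_simp
  have hlog : Tendsto (fun m => (p m : ℂ) * Complex.log (1 + (f m - 1))) atTop (𝓝 c) := by
    have hdiff : Tendsto (fun m => (p m : ℂ) * Complex.log (1 + (f m - 1)) -
        (p m : ℂ) * (f m - 1)) atTop (𝓝 0) := by
      have hb : Tendsto (fun m => ‖(p m : ℂ) * (f m - 1)‖ * ‖f m - 1‖) atTop (𝓝 0) := by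
        simpa using hf.norm.mul hz.norm
      refine squeeze_zero_norm' ?_ hb
      have hsmall : ∀ᶠ m in atTop, ‖f m - 1‖ < 1 / 2 :=
        (tendsto_order.mp (by simpa using hz.norm)).2 _ (by norm_num)
      filter_upwards [hsmall] with m hm
      have h1 := Complex.norm_log_one_add_sub_self_le (hm.trans (by norm_num))
      have h2 : (1 - ‖f m - 1‖)⁻¹ ≤ 2 := by
        rw [inv_le_comm₀ (by linarith) (by norm_num)]
        linarith
      rw [← mul_sub, norm_mul, norm_mul, mul_assoc]
      gcongr
      nlinarith [sq_nonneg ‖f m - 1‖]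
    simpa using hdiff.add hf
  refine ((Complex.continuous_exp.tendsto c).comp hlog).congr' ?_
  have hne : ∀ᶠ m in atTop, f m ≠ 0 := by
    have : Tendsto f atTop (𝓝 1) := by simpa using hz.add_const 1
    exact this.eventually_ne one_ne_zero
  filter_upwards [hne] with m hm
  simp only [Function.comp_apply, add_sub_cancel]
  rw [Complex.exp_nat_mul, Complex.exp_log hm]

/-- **Central limit theorem for row-wise i.i.d. triangular arrays** with bounded third central
moments. The centering `a m` may differ from the mean of a summand by `o(1 / √(p m))`. -/
theorem tendstoInDistribution_of_iid_rows {Ω : ℕ → Type*} [∀ m, MeasurableSpace (Ω m)]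
    {P : ∀ m, Measure (Ω m)} [∀ m, IsProbabilityMeasure (P m)] {p : ℕ → ℕ}
    {W : ∀ m, Fin (p m) → Ω m → ℝ} {ρ : ℕ → Measure ℝ} [∀ m, IsProbabilityMeasure (ρ m)]
    (hlaw : ∀ m j, HasLaw (W m j) (ρ m) (P m)) (hind : ∀ m, iIndepFun (W m) (P m))
    (hp : Tendsto p atTop atTop) {v C : ℝ} (hv : 0 < v) {a : ℕ → ℝ}
    (hmem : ∀ᶠ m in atTop, MemLp id 3 (ρ m))
    (hC : ∀ᶠ m in atTop, ∫ x, |x - ∫ y, y ∂(ρ m)| ^ 3 ∂(ρ m) ≤ C)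
    (hvar : Tendsto (fun m => Var[id; ρ m]) atTop (𝓝 v))
    (ha : Tendsto (fun m => √(p m) * ((∫ y, y ∂(ρ m)) - a m)) atTop (𝓝 0)) :
    TendstoInDistribution (fun m ω => (∑ j, W m j ω - p m * a m) / √(p m * v)) atTop
      (id : ℝ → ℝ) P (gaussianReal 0 1) where
  forall_aemeasurable m :=
    ((Finset.aemeasurable_fun_sum _ fun j _ => (hlaw m j).aemeasurable).sub_const _).div_const _
  aemeasurable_limit := aemeasurable_id
  tendsto := by
    refine ProbabilityMeasure.tendsto_of_tendsto_charFun fun t => ?_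
    simp only [ProbabilityMeasure.coe_mk, Measure.map_id]
    set M : ℕ → ℝ := fun m => ∫ y, y ∂(ρ m) with hM
    let ρ₀ : ℕ → Measure ℝ := fun m => (ρ m).map fun x => x - M m
    have hρ₀ (m : ℕ) : ρ₀ m = (ρ m).map fun x => x - M m := rfl
    have hρ₀P (m : ℕ) : IsProbabilityMeasure (ρ₀ m) :=
      Measure.isProbabilityMeasure_map (by fun_prop)
    set s : ℕ → ℝ := fun m => t / √(p m * v) with hs
    have hchar (m : ℕ) : charFun ((P m).map
        (fun ω => (∑ j, W m j ω - p m * a m) / √(p m * v))) t =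
          charFun (ρ₀ m) (s m) ^ p m * Complex.exp ((s m * (p m * (M m - a m)) : ℝ) * Complex.I) := by
      have hWm (j : Fin (p m)) : AEMeasurable (fun ω => W m j ω - M m) (P m) :=
        (hlaw m j).aemeasurable.sub_const _
      have hWlaw (j : Fin (p m)) : (P m).map (fun ω => W m j ω - M m) = ρ₀ m := by
        rw [hρ₀, ← (hlaw m j).map_eq, AEMeasurable.map_map_of_aemeasurable (by fun_prop)
          (hlaw m j).aemeasurable]
        rfl
      have hindc : iIndepFun (fun j ω => W m j ω - M m) (P m) :=
        (hind m).comp (fun _ x => x - M m) fun _ => by fun_prop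
      have hsum : AEMeasurable (fun ω => ∑ j, (W m j ω - M m)) (P m) :=
        Finset.aemeasurable_fun_sum _ fun j _ => hWm j
      have h1 : charFun ((P m).map fun ω => ∑ j, (W m j ω - M m)) (s m) =
          charFun (ρ₀ m) (s m) ^ p m := by
        rw [iIndepFun.charFun_map_fun_finsetSum_eq_prod (s := Finset.univ) (fun j _ => hWm j)
          (hindc.restrict _)]
        simp [hWlaw]
      rw [← h1, charFun_apply_real, charFun_apply_real, integral_map _ (by fun_prop),
        integral_map hsum (by fun_prop), ← integral_mul_const]
      · congr 1
        ext ω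
        rw [← Complex.exp_add]
        congr 1
        simp only [hs, Finset.sum_sub_distrib, Finset.sum_const, Finset.card_univ, Fintype.card_fin,
          nsmul_eq_mul]
        push_cast
        ring
      · exact ((Finset.aemeasurable_fun_sum _ fun j _ =>
          (hlaw m j).aemeasurable).sub_const _).div_const _
    have hp1 : ∀ᶠ m in atTop, (0 : ℝ) < p m := by
      filter_upwards [hp.eventually_ge_atTop 1] with m hm
      exact_mod_cast hm
    have hps (m : ℕ) (hm : (0 : ℝ) < p m) : (p m : ℝ) * s m ^ 2 = t ^ 2 / v := by
      rw [hs, div_pow, Real.sq_sqrt (by positivity)]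
      field_simp
    have hs0 : Tendsto s atTop (𝓝 0) := by
      refine Tendsto.const_div_atTop ?_ t
      exact Real.tendsto_sqrt_atTop.comp
        ((tendsto_natCast_atTop_atTop.comp hp).atTop_mul_const hv)
    have hshift : Tendsto (fun m => s m * (p m * (M m - a m))) atTop (𝓝 0) := by
      have := ha.const_mul (t / √v)
      rw [mul_zero] at this
      refine this.congr' ?_
      filter_upwards [hp1] with m hm
      have hsp := Real.sqrt_pos.mpr hm
      have hsv := Real.sqrt_pos.mpr hv
      change t / √v * (√(p m) * (M m - a m)) = t / √(p m * v) * (p m * (M m - a m))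
      rw [Real.sqrt_mul hm.le]
      field_simp
      rw [Real.sq_sqrt hm.le]
      ring
    have hexp : Tendsto (fun m => Complex.exp ((s m * (p m * (M m - a m)) : ℝ) * Complex.I))
        atTop (𝓝 1) := by
      have h : Continuous fun x : ℝ => Complex.exp (x * Complex.I) := by fun_prop
      exact (h.tendsto' 0 1 (by simp)).comp hshift
    have hpow : Tendsto (fun m => charFun (ρ₀ m) (s m) ^ p m) atTop
        (𝓝 (Complex.exp (-(t ^ 2) / 2 : ℝ))) := by
      refine tendsto_pow_exp_of_tendsto_mul_sub_one hp ?_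
      have hmain : Tendsto (fun m => ((-(t ^ 2 / v * Var[id; ρ m]) / 2 : ℝ) : ℂ)) atTop
          (𝓝 ((-(t ^ 2) / 2 : ℝ) : ℂ)) := by
        refine (Complex.continuous_ofReal.tendsto _).comp ?_
        have := ((hvar.const_mul (t ^ 2 / v)).neg).div_const 2
        rwa [div_mul_cancel₀ _ hv.ne'] at this
      have herr : Tendsto (fun m => (p m : ℂ) * (charFun (ρ₀ m) (s m) - 1) -
          ((-(t ^ 2 / v * Var[id; ρ m]) / 2 : ℝ) : ℂ)) atTop (𝓝 0) := by
        have hb : Tendsto (fun m => 4 * (t ^ 2 / v) * |s m| * C) atTop (𝓝 0) := by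
          simpa using (hs0.abs.const_mul (4 * (t ^ 2 / v))).mul_const C
        refine squeeze_zero_norm' ?_ hb
        filter_upwards [hmem, hC, hp1] with m hm hCm hpm
        have hint : Integrable (fun x : ℝ => x) (ρ m) := hm.integrable (by norm_num)
        have hmem₀ : MemLp id 3 (ρ₀ m) := by
          rw [hρ₀, memLp_map_measure_iff (by fun_prop) (by fun_prop)]
          exact hm.sub (memLp_const _)
        have hmean₀ : ∫ x, x ∂(ρ₀ m) = 0 := by
          rw [hρ₀, integral_map (by fun_prop) (by fun_prop), integral_sub hint (integrable_const _)]
          simp [hM]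
        have hsq₀ : ∫ x, x ^ 2 ∂(ρ₀ m) = Var[id; ρ m] := by
          rw [hρ₀, integral_map (by fun_prop) (by fun_prop),
            variance_eq_integral (by fun_prop)]
          rfl
        have hcube₀ : ∫ x, |x| ^ 3 ∂(ρ₀ m) ≤ C := by
          rw [hρ₀, integral_map (by fun_prop) (by fun_prop)]
          exact hCm
        have hT := norm_charFun_sub_le hmem₀ hmean₀ (s m)
        rw [hsq₀] at hT
        have e : (p m : ℂ) * (charFun (ρ₀ m) (s m) - 1) -
            ((-(t ^ 2 / v * Var[id; ρ m]) / 2 : ℝ) : ℂ) =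
            (p m : ℂ) * (charFun (ρ₀ m) (s m) - (1 - s m ^ 2 * (Var[id; ρ m] : ℝ) / 2)) := by
          rw [← hps m hpm]
          push_cast
          ring
        rw [e, norm_mul, Complex.norm_natCast]
        calc (p m : ℝ) * ‖charFun (ρ₀ m) (s m) - (1 - s m ^ 2 * (Var[id; ρ m] : ℝ) / 2)‖
            ≤ p m * (4 * |s m| ^ 3 * C) := by
              gcongr
              exact hT.trans (by gcongr)
          _ = 4 * (p m * s m ^ 2) * |s m| * C := by
              rw [← sq_abs (s m)]
              ring
          _ = 4 * (t ^ 2 / v) * |s m| * C := by rw [hps m hpm]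
      simpa using herr.add hmain
    simp only [hchar]
    have := hpow.mul hexp
    rw [mul_one] at this
    convert this using 2
    rw [charFun_gaussianReal]
    congr 1
    simp
    ring

/-! ### The law of a summand, and Taylor's formula for the logarithm -/

lemma nu₂_pos {N : ℕ} (hN : 3 ≤ N) : 0 < nu₂ N := by
  have : (3 : ℝ) ≤ N := by exact_mod_cast hN
  unfold nu₂
  linarith

lemma measurable_mul_log_one_add (N : ℕ) : Measurable fun y : ℝ => (N : ℝ) * Real.log (1 + y) := by
  fun_prop

lemma isProbabilityMeasure_logTermLaw {N : ℕ} (hN : 3 ≤ N) :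
    IsProbabilityMeasure (logTermLaw N) := by
  have := isProbabilityMeasure_betaPrimeMeasure (α := 1 / 2) (β := nu₂ N / 2) (by norm_num)
    (half_pos (nu₂_pos hN))
  exact Measure.isProbabilityMeasure_map (measurable_mul_log_one_add N).aemeasurable

lemma integral_logTermLaw (N : ℕ) {f : ℝ → ℝ} (hf : Measurable f) :
    ∫ x, f x ∂(logTermLaw N) =
      ∫ y, f (N * Real.log (1 + y)) ∂(betaPrimeMeasure (1 / 2) (nu₂ N / 2)) :=
  integral_map (measurable_mul_log_one_add N).aemeasurable hf.aestronglyMeasurable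

lemma memLp_logTermLaw {N : ℕ} (hN : 3 ≤ N) : MemLp id 3 (logTermLaw N) := by
  rw [logTermLaw, memLp_map_measure_iff (by fun_prop) (measurable_mul_log_one_add N).aemeasurable]
  exact (memLp_log_one_add_betaPrimeMeasure (by norm_num) (half_pos (nu₂_pos hN)) 3).const_mul _

lemma integral_id_logTermLaw {N : ℕ} (hN : 3 ≤ N) : ∫ x, x ∂(logTermLaw N) = G₁ N := by
  rw [integral_logTermLaw N (f := fun x => x) measurable_id, G₁,
    ← integral_log_one_add_betaPrimeMeasure (nu₂_pos hN), ← integral_const_mul]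

lemma variance_logTermLaw (N : ℕ) :
    Var[id; logTermLaw N] = (N : ℝ) ^ 2 *
      Var[fun y => Real.log (1 + y); betaPrimeMeasure (1 / 2) (nu₂ N / 2)] := by
  rw [logTermLaw, variance_id_map (measurable_mul_log_one_add N).aemeasurable, variance_const_mul]

lemma variance_logTermLaw_eq {N : ℕ} (hN : 3 ≤ N) :
    Var[id; logTermLaw N] = G₂ N - G₁ N ^ 2 := by
  rw [variance_logTermLaw, variance_log_one_add_betaPrimeMeasure (nu₂_pos hN), G₁, G₂]
  ring

lemma G₂_sub_G₁_sq_pos {N : ℕ} (hN : 3 ≤ N) : 0 < G₂ N - G₁ N ^ 2 := by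
  rw [← variance_logTermLaw_eq hN, variance_logTermLaw]
  have := variance_log_one_add_betaPrimeMeasure_pos (α := 1 / 2) (β := nu₂ N / 2) (by norm_num)
    (half_pos (nu₂_pos hN))
  have : (0 : ℝ) < N := by exact_mod_cast (by lia : 0 < N)
  positivity

lemma one_add_mul_sum_alternating (y : ℝ) (k : ℕ) :
    (1 + y) * ∑ i ∈ Finset.Icc 1 k, (-1 : ℝ) ^ (i + 1) * y ^ (i - 1) = 1 - (-y) ^ k := by
  induction k with
  | zero => simp
  | succ k ih =>
    rw [Finset.sum_Icc_succ_top (by lia), mul_add, ih, Nat.add_sub_cancel, neg_pow y, neg_pow y]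
    ring

/-- Taylor's formula for `log (1 + y)` at `0`, with a remainder bound valid for all `y ≥ 0`. -/
lemma abs_log_one_add_sub_sum_le {y : ℝ} (hy : 0 ≤ y) (k : ℕ) :
    |Real.log (1 + y) - ∑ i ∈ Finset.Icc 1 k, (-1 : ℝ) ^ (i + 1) * y ^ i / i| ≤
      y ^ (k + 1) / (k + 1) := by
  have hder (x : ℝ) (hx : 0 ≤ x) : HasDerivAt
      (fun x => Real.log (1 + x) - ∑ i ∈ Finset.Icc 1 k, (-1 : ℝ) ^ (i + 1) * x ^ i / i)
      ((-x) ^ k / (1 + x)) x := by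
    have h1 : HasDerivAt (fun x => Real.log (1 + x)) (1 / (1 + x)) x :=
      ((hasDerivAt_id x).const_add 1).log (by simp; linarith)
    have h2 : HasDerivAt (fun x => ∑ i ∈ Finset.Icc 1 k, (-1 : ℝ) ^ (i + 1) * x ^ i / i)
        (∑ i ∈ Finset.Icc 1 k, (-1 : ℝ) ^ (i + 1) * x ^ (i - 1)) x := by
      refine HasDerivAt.fun_sum fun i hi => ?_
      have hi0 : (i : ℝ) ≠ 0 := by
        have := (Finset.mem_Icc.mp hi).1
        exact_mod_cast (by lia : i ≠ 0)
      refine (((hasDerivAt_pow i x).const_mul ((-1 : ℝ) ^ (i + 1))).div_const (i : ℝ)).congr_deriv ?_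
      field_simp
    refine (h1.sub h2).congr_deriv ?_
    have := one_add_mul_sum_alternating x k
    have hx1 : 1 + x ≠ 0 := by linarith
    rw [eq_div_iff hx1, sub_mul, one_div_mul_cancel hx1]
    linarith
  have hB (x : ℝ) : HasDerivAt (fun x : ℝ => x ^ (k + 1) / (k + 1)) (x ^ k) x := by
    refine ((hasDerivAt_pow (k + 1) x).div_const ((k : ℝ) + 1)).congr_deriv ?_
    have : (k : ℝ) + 1 ≠ 0 := by positivity
    push_cast
    rw [mul_div_cancel_left₀ _ this]
  have h := image_norm_le_of_norm_deriv_right_le_deriv_boundary (a := 0) (b := y)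
    (fun x hx => (hder x hx.1).continuousAt.continuousWithinAt)
    (fun x hx => (hder x hx.1).hasDerivWithinAt) (B := fun x => x ^ (k + 1) / (k + 1)) ?_ hB ?_
    (right_mem_Icc.mpr hy)
  · simpa using h
  · have : ∑ i ∈ Finset.Icc 1 k, (-1 : ℝ) ^ (i + 1) * 0 ^ i / i = 0 := by
      refine Finset.sum_eq_zero fun i hi => ?_
      have : i ≠ 0 := by have := (Finset.mem_Icc.mp hi).1; lia
      simp [this]
    simp [this]
  · intro x hx
    have hx0 : 0 ≤ x := hx.1
    rw [norm_div, norm_pow, norm_neg, Real.norm_of_nonneg hx0, Real.norm_of_nonneg (by linarith)]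
    exact div_le_self (pow_nonneg hx0 k) (by linarith)

lemma log_one_add_nonneg_le {y : ℝ} (hy : 0 ≤ y) :
    0 ≤ Real.log (1 + y) ∧ Real.log (1 + y) ≤ y :=
  ⟨Real.log_nonneg (by linarith), by
    have := Real.log_le_sub_one_of_pos (show 0 < 1 + y by linarith)
    linarith⟩

lemma sub_pow_three_le_log_one_add_sq {y : ℝ} (hy : 0 ≤ y) :
    y ^ 2 - y ^ 3 ≤ Real.log (1 + y) ^ 2 := by
  have h := (abs_le.mp (abs_log_one_add_sub_sum_le hy 1)).1
  norm_num at h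
  rcases le_total y 1 with h1 | h1
  · have h2 : 0 ≤ y - y ^ 2 / 2 := by nlinarith
    have h3 := pow_le_pow_left₀ h2 (show y - y ^ 2 / 2 ≤ Real.log (1 + y) by linarith) 2
    nlinarith [sq_nonneg (y ^ 2)]
  · have : y ^ 2 - y ^ 3 ≤ 0 := by nlinarith [mul_nonneg (sq_nonneg y) (sub_nonneg.mpr h1)]
    exact this.trans (sq_nonneg _)

/-- The leading order of the `i`-th moment of `t² / ν₂` is `N ^ (-i)`. -/
lemma tendsto_pow_mul_b (i : ℕ) :
    Tendsto (fun N : ℕ => (N : ℝ) ^ i * b N i) atTop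
      (𝓝 (∏ l ∈ Finset.Icc 1 i, (2 * (l : ℝ) - 1))) := by
  have h (N : ℕ) : (N : ℝ) ^ i * b N i =
      ∏ l ∈ Finset.Icc 1 i, (N : ℝ) * ((2 * (l : ℝ) - 1) / (nu₂ N - 2 * (l : ℝ))) := by
    rw [b, Finset.prod_mul_distrib]
    simp
  simp only [h]
  refine tendsto_finsetProd _ fun l _ => ?_
  have h1 : Tendsto (fun N : ℕ => (2 * (l : ℝ) - 1) / (1 - (2 + 2 * (l : ℝ)) / N)) atTop
      (𝓝 ((2 * (l : ℝ) - 1) / (1 - 0))) :=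
    tendsto_const_nhds.div (tendsto_const_nhds.sub (tendsto_const_div_atTop_nhds_zero_nat _))
      (by norm_num)
  rw [sub_zero, div_one] at h1
  refine h1.congr' ?_
  filter_upwards [eventually_gt_atTop (2 + 2 * l)] with N hN
  have hN' : (2 + 2 * (l : ℝ)) < N := by exact_mod_cast hN
  have hN0 : (0 : ℝ) < N := lt_of_le_of_lt (by positivity) hN'
  have h2 : (N : ℝ) - (2 + 2 * l) ≠ 0 := by linarith
  have h3 : nu₂ N - 2 * l = N - (2 + 2 * l) := by unfold nu₂; ring
  rw [h3]
  field_simp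

lemma tendsto_pow_mul_b_zero {i j : ℕ} (hij : i < j) :
    Tendsto (fun N : ℕ => (N : ℝ) ^ i * b N j) atTop (𝓝 0) := by
  have h := (tendsto_pow_mul_b j).mul
    ((tendsto_inv_atTop_nhds_zero_nat (𝕜 := ℝ)).pow (j - i))
  rw [zero_pow (by lia), mul_zero] at h
  refine h.congr' ?_
  filter_upwards [eventually_gt_atTop 0] with N hN
  have hN0 : (N : ℝ) ^ (j - i) ≠ 0 := pow_ne_zero _ (by exact_mod_cast hN.ne')
  rw [show (N : ℝ) ^ j = N ^ i * N ^ (j - i) by rw [← pow_add]; congr 1; lia, inv_pow]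
  field_simp

/-! ### Asymptotics for large samples -/

lemma integrable_pow_betaPrimeMeasure_half {N i : ℕ} (hi : 2 * (i : ℝ) < nu₂ N) :
    Integrable (fun y => y ^ i) (betaPrimeMeasure (1 / 2) (nu₂ N / 2)) :=
  integrable_pow_betaPrimeMeasure (by norm_num) (by linarith)

lemma integrable_log_one_add_pow (N : ℕ) (hN : 3 ≤ N) (i : ℕ) :
    Integrable (fun y => Real.log (1 + y) ^ i) (betaPrimeMeasure (1 / 2) (nu₂ N / 2)) := by
  have h := memLp_log_one_add_betaPrimeMeasure (α := 1 / 2) (β := nu₂ N / 2) (by norm_num)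
    (half_pos (nu₂_pos hN)) i
  have := isProbabilityMeasure_betaPrimeMeasure (α := 1 / 2) (β := nu₂ N / 2) (by norm_num)
    (half_pos (nu₂_pos hN))
  refine (h.integrable_norm_pow').mono'
    (Measurable.aestronglyMeasurable (by fun_prop)) (.of_forall fun y => ?_)
  simp

/-- Integrating the Taylor expansion of `log (1 + y)`: the mean of a summand of `T₂` differs from
its approximation `eta N k` by at most the next term. -/
lemma abs_G₁_sub_eta_le {N k : ℕ} (hk : 2 * ((k + 1 : ℕ) : ℝ) < nu₂ N) :
    |G₁ N - eta N k| ≤ N * b N (k + 1) / (k + 1) := by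
  have hk0 : (0 : ℝ) ≤ ((k + 1 : ℕ) : ℝ) := Nat.cast_nonneg _
  have hν : 0 < nu₂ N := by linarith
  have hN : 3 ≤ N := by
    have : (2 : ℝ) < N := by unfold nu₂ at hν; linarith
    exact_mod_cast this
  set ρ := betaPrimeMeasure (1 / 2) (nu₂ N / 2)
  have hint : ∀ i ∈ Finset.Icc 1 k, Integrable (fun y => (-1 : ℝ) ^ (i + 1) * y ^ i / i) ρ := by
    intro i hi
    have hi' : (i : ℝ) ≤ ((k + 1 : ℕ) : ℝ) := by
      exact_mod_cast (Finset.mem_Icc.mp hi).2.trans (Nat.le_succ k)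
    exact ((integrable_pow_betaPrimeMeasure_half (by linarith)).const_mul _).div_const _
  have hsum : ∑ i ∈ Finset.Icc 1 k, (-1 : ℝ) ^ (i + 1) * b N i / i =
      ∫ y, (∑ i ∈ Finset.Icc 1 k, (-1 : ℝ) ^ (i + 1) * y ^ i / i) ∂ρ := by
    rw [integral_finsetSum _ hint]
    refine Finset.sum_congr rfl fun i hi => ?_
    have hi' : (i : ℝ) ≤ ((k + 1 : ℕ) : ℝ) := by
      exact_mod_cast (Finset.mem_Icc.mp hi).2.trans (Nat.le_succ k)
    rw [integral_div, integral_const_mul, integral_pow_betaPrimeMeasure_half (by linarith)]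
  have hL : Integrable (fun y => Real.log (1 + y)) ρ := by
    simpa only [pow_one] using integrable_log_one_add_pow N hN 1
  rw [G₁, eta, ← mul_sub, abs_mul, Nat.abs_cast, mul_div_assoc,
    ← integral_log_one_add_betaPrimeMeasure hν, hsum,
    ← integral_sub hL (integrable_finsetSum _ hint),
    ← integral_pow_betaPrimeMeasure_half hk, ← integral_div]
  gcongr
  rw [← Real.norm_eq_abs]
  refine norm_integral_le_of_norm_le
    ((integrable_pow_betaPrimeMeasure_half hk).div_const _) ?_
  filter_upwards [ae_pos_betaPrimeMeasure _ _] with y hy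
  exact abs_log_one_add_sub_sum_le hy.le k

lemma eventually_lt_nu₂ (c : ℝ) : ∀ᶠ N : ℕ in atTop, c < nu₂ N := by
  filter_upwards [tendsto_natCast_atTop_atTop.eventually_gt_atTop (c + 2)] with N hN
  unfold nu₂
  linarith

lemma tendsto_G₁ : Tendsto G₁ atTop (𝓝 1) := by
  have h0 : Tendsto (fun N : ℕ => (N : ℝ) * b N 1) atTop (𝓝 1) := by
    have := tendsto_pow_mul_b 1
    norm_num at this
    exact this
  have h1 : Tendsto (fun N => eta N 1) atTop (𝓝 1) := by
    simpa [eta] using h0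
  have h2 : Tendsto (fun N => G₁ N - eta N 1) atTop (𝓝 0) := by
    have hb := (tendsto_pow_mul_b_zero (show 1 < 2 by norm_num)).div_const 2
    rw [zero_div] at hb
    refine squeeze_zero_norm' ?_ hb
    filter_upwards [eventually_lt_nu₂ 4] with N hN
    have := abs_G₁_sub_eta_le (N := N) (k := 1) (by norm_num; exact hN)
    norm_num at this ⊢
    exact this
  simpa using h2.add h1

/-- A summand of `T₂` behaves like a squared standard normal variable for large `N`, whose variance
is `2`. -/
lemma tendsto_variance_logTermLaw : Tendsto (fun N => Var[id; logTermLaw N]) atTop (𝓝 2) := by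
  set R : ℕ → Measure ℝ := fun N => betaPrimeMeasure (1 / 2) (nu₂ N / 2) with hR
  have hb2 : Tendsto (fun N : ℕ => (N : ℝ) ^ 2 * b N 2) atTop (𝓝 3) := by
    have := tendsto_pow_mul_b 2
    norm_num [Finset.prod_Icc_succ_top] at this
    exact this
  have hlow : Tendsto (fun N : ℕ => (N : ℝ) ^ 2 * (b N 2 - b N 3)) atTop (𝓝 3) := by
    have := hb2.sub (tendsto_pow_mul_b_zero (show 2 < 3 by norm_num))
    simpa only [mul_sub, sub_zero] using this
  have hsq : Tendsto (fun N : ℕ => (N : ℝ) ^ 2 * ∫ y, Real.log (1 + y) ^ 2 ∂(R N)) atTop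
      (𝓝 3) := by
    refine tendsto_of_tendsto_of_tendsto_of_le_of_le' hlow hb2 ?_ ?_
    · filter_upwards [eventually_lt_nu₂ 6, eventually_ge_atTop 3] with N hN hN3
      gcongr
      have i2 := integrable_pow_betaPrimeMeasure_half (N := N) (i := 2) (by norm_num; linarith)
      have i3 := integrable_pow_betaPrimeMeasure_half (N := N) (i := 3) (by norm_num; linarith)
      rw [← integral_pow_betaPrimeMeasure_half (N := N) (i := 2) (by norm_num; linarith),
        ← integral_pow_betaPrimeMeasure_half (N := N) (i := 3) (by norm_num; linarith),
        ← integral_sub i2 i3]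
      refine integral_mono_ae (i2.sub i3) (integrable_log_one_add_pow N hN3 2) ?_
      filter_upwards [ae_pos_betaPrimeMeasure _ _] with y hy
      exact sub_pow_three_le_log_one_add_sq hy.le
    · filter_upwards [eventually_lt_nu₂ 6, eventually_ge_atTop 3] with N hN hN3
      gcongr
      have i2 := integrable_pow_betaPrimeMeasure_half (N := N) (i := 2) (by norm_num; linarith)
      rw [← integral_pow_betaPrimeMeasure_half (N := N) (i := 2) (by norm_num; linarith)]
      refine integral_mono_ae (integrable_log_one_add_pow N hN3 2) i2 ?_
      filter_upwards [ae_pos_betaPrimeMeasure _ _] with y hy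
      exact pow_le_pow_left₀ (log_one_add_nonneg_le hy.le).1 (log_one_add_nonneg_le hy.le).2 2
  have h := hsq.sub (tendsto_G₁.pow 2)
  norm_num at h
  refine h.congr' ?_
  filter_upwards [eventually_ge_atTop 3] with N hN3
  have := isProbabilityMeasure_betaPrimeMeasure (α := 1 / 2) (β := nu₂ N / 2) (by norm_num)
    (half_pos (nu₂_pos hN3))
  rw [variance_logTermLaw, variance_eq_sub (memLp_log_one_add_betaPrimeMeasure (by norm_num)
    (half_pos (nu₂_pos hN3)) 2), integral_log_one_add_betaPrimeMeasure (nu₂_pos hN3), mul_sub, G₁,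
    mul_pow]
  rfl

lemma exists_eventually_integral_abs_pow_three_le : ∃ C : ℝ, ∀ᶠ N : ℕ in atTop,
    ∫ x, |x - ∫ y, y ∂(logTermLaw N)| ^ 3 ∂(logTermLaw N) ≤ C := by
  have hlim : Tendsto (fun N : ℕ => 4 * ((N : ℝ) ^ 3 * b N 3 + |G₁ N| ^ 3)) atTop _ :=
    ((tendsto_pow_mul_b 3).add (tendsto_G₁.abs.pow 3)).const_mul 4
  obtain ⟨C, hC⟩ := hlim.isBoundedUnder_le
  refine ⟨C, ?_⟩
  filter_upwards [eventually_map.mp hC, eventually_lt_nu₂ 6, eventually_ge_atTop 3]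
    with N hNC hN hN3
  refine le_trans ?_ hNC
  have := isProbabilityMeasure_betaPrimeMeasure (α := 1 / 2) (β := nu₂ N / 2) (by norm_num)
    (half_pos (nu₂_pos hN3))
  have i3 := integrable_pow_betaPrimeMeasure_half (N := N) (i := 3) (by norm_num; linarith)
  have ib : Integrable (fun y : ℝ => 4 * ((N : ℝ) ^ 3 * y ^ 3 + |G₁ N| ^ 3))
      (betaPrimeMeasure (1 / 2) (nu₂ N / 2)) :=
    ((i3.const_mul _).add (integrable_const _)).const_mul 4
  rw [integral_id_logTermLaw hN3, integral_logTermLaw N (f := fun x => |x - G₁ N| ^ 3)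
    (by fun_prop)]
  calc ∫ y, |(N : ℝ) * Real.log (1 + y) - G₁ N| ^ 3 ∂(betaPrimeMeasure (1 / 2) (nu₂ N / 2))
      ≤ ∫ y, 4 * ((N : ℝ) ^ 3 * y ^ 3 + |G₁ N| ^ 3) ∂(betaPrimeMeasure (1 / 2) (nu₂ N / 2)) := by
        refine integral_mono_of_nonneg (.of_forall fun y => by positivity) ib ?_
        filter_upwards [ae_pos_betaPrimeMeasure _ _] with y hy
        obtain ⟨h1, h2⟩ := log_one_add_nonneg_le hy.le
        have h3 : |(N : ℝ) * Real.log (1 + y) - G₁ N| ≤ N * y + |G₁ N| := by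
          refine (abs_sub _ _).trans ?_
          rw [abs_of_nonneg (by positivity)]
          gcongr
        calc |(N : ℝ) * Real.log (1 + y) - G₁ N| ^ 3 ≤ (N * y + |G₁ N|) ^ 3 := by gcongr
          _ ≤ 2 ^ (3 - 1) * ((N * y) ^ 3 + |G₁ N| ^ 3) :=
            add_pow_le (by positivity) (abs_nonneg _) 3
          _ = 4 * ((N : ℝ) ^ 3 * y ^ 3 + |G₁ N| ^ 3) := by rw [mul_pow]; norm_num
    _ = 4 * ((N : ℝ) ^ 3 * b N 3 + |G₁ N| ^ 3) := by
        rw [integral_const_mul, integral_add (i3.const_mul _) (integrable_const _),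
          integral_const_mul, integral_pow_betaPrimeMeasure_half (by norm_num; linarith),
          integral_const, probReal_univ, one_smul]

/-- The error of the approximate centering is negligible when `p = o(N ^ (2 k))`. -/
lemma tendsto_sqrt_mul_G₁_sub_eta {p N : ℕ → ℕ} (hN : Tendsto N atTop atTop) (k : ℕ)
    (hpN : (fun m => (p m : ℝ)) =o[atTop] fun m => (N m : ℝ) ^ (2 * k)) :
    Tendsto (fun m => √(p m) * (G₁ (N m) - eta (N m) k)) atTop (𝓝 0) := by
  have h1 : Tendsto (fun m => √(p m / (N m : ℝ) ^ (2 * k))) atTop (𝓝 0) := by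
    have := (Real.continuous_sqrt.tendsto 0).comp hpN.tendsto_div_nhds_zero
    rwa [Real.sqrt_zero] at this
  have h2 := ((tendsto_pow_mul_b (k + 1)).comp hN).div_const ((k : ℝ) + 1)
  have h3 := h1.mul h2
  rw [zero_mul] at h3
  refine squeeze_zero_norm' ?_ h3
  filter_upwards [hN.eventually (eventually_lt_nu₂ (2 * ((k + 1 : ℕ) : ℝ))),
    hN.eventually_ge_atTop 1] with m hm hm1
  have hN0 : (0 : ℝ) < N m := by exact_mod_cast hm1
  rw [norm_mul, Real.norm_of_nonneg (Real.sqrt_nonneg _), Real.norm_eq_abs]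
  calc √(p m) * |G₁ (N m) - eta (N m) k| ≤ √(p m) * (N m * b (N m) (k + 1) / (k + 1)) := by
        gcongr
        exact abs_G₁_sub_eta_le hm
    _ = _ := by
        rw [pow_mul', Real.sqrt_div (Nat.cast_nonneg _), Real.sqrt_sq (by positivity)]
        simp only [Function.comp_apply]
        field_simp
        ring

end DLRT

end

theorem corollary2 {Ω : ℕ → Type*} [∀ m, MeasurableSpace (Ω m)]
    (P : ∀ m, Measure (Ω m)) [∀ m, IsProbabilityMeasure (P m)]
    -- sample sizes and dimension of the `m`-th experiment
    (n₁ n₂ p : ℕ → ℕ) (hn₁ : ∀ m, 1 ≤ n₁ m) (hn₂ : ∀ m, 1 ≤ n₂ m)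
    -- population means and the common diagonal, nonsingular covariance matrix
    (μ₁ μ₂ : ∀ m, EuclideanSpace ℝ (Fin (p m)))
    (S : ∀ m, Matrix (Fin (p m)) (Fin (p m)) ℝ)
    (hSpos : ∀ m, (S m).PosDef) (hSdiag : ∀ m, (S m).IsDiag)
    -- the two independent i.i.d. normal samples
    (X : ∀ m, Fin (n₁ m) → Ω m → EuclideanSpace ℝ (Fin (p m)))
    (Y : ∀ m, Fin (n₂ m) → Ω m → EuclideanSpace ℝ (Fin (p m)))
    (hX : ∀ m i, HasLaw (X m i) (multivariateGaussian (μ₁ m) (S m)) (P m))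
    (hY : ∀ m i, HasLaw (Y m i) (multivariateGaussian (μ₂ m) (S m)) (P m))
    (hXY : ∀ m, iIndepFun (Sum.elim (X m) (Y m)) (P m))
    -- the null hypothesis
    (H₀ : ∀ m, μ₁ m = μ₂ m) :
    (∀ N : ℕ, 4 ≤ N → (∀ m, n₁ m + n₂ m = N) → Tendsto p atTop atTop →
      TendstoInDistribution
        (fun m ω => (DLRT.T₂ (fun i => X m i ω) (fun i => Y m i ω) - (p m : ℝ) * DLRT.G₁ N) /
          √((p m : ℝ) * (DLRT.G₂ N - DLRT.G₁ N ^ 2)))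
        atTop (id : ℝ → ℝ) P (gaussianReal 0 1)) ∧
    (∀ k : ℕ, 1 ≤ k → (∀ m, (k : ℝ) < DLRT.nu₂ (n₁ m + n₂ m) / 2) →
      Tendsto (fun m => n₁ m + n₂ m) atTop atTop → Tendsto p atTop atTop →
      (fun m => (p m : ℝ)) =o[atTop] (fun m => ((n₁ m + n₂ m : ℕ) : ℝ) ^ (2 * k)) →
      TendstoInDistribution
        (fun m ω => (DLRT.T₂ (fun i => X m i ω) (fun i => Y m i ω) -
            (p m : ℝ) * DLRT.eta (n₁ m + n₂ m) k) / √(2 * (p m : ℝ)))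
        atTop (id : ℝ → ℝ) P (gaussianReal 0 1)) := by

  have hH (m : ℕ) : μ₂ m = μ₁ m := (H₀ m).symm
  have hiid (m : ℕ) (hN : 3 ≤ n₁ m + n₂ m) := DLRT.iIndepFun_logTerm_and_hasLaw
    (Nat.one_le_iff_ne_zero.mp (hn₁ m)) (Nat.one_le_iff_ne_zero.mp (hn₂ m)) hN (hSpos m) (hSdiag m)
    (hX m) (fun i => hH m ▸ hY m i) (hXY m)
  constructor
  -- for fixed `N` all rows have the same law, so the moment conditions hold trivially
  · intro N hN hNm hp
    have hN3 (m : ℕ) : 3 ≤ n₁ m + n₂ m := by have := hNm m; lia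
    have (m : ℕ) := DLRT.isProbabilityMeasure_logTermLaw (hN3 m)
    have h := DLRT.tendstoInDistribution_of_iid_rows (fun m => (hiid m (hN3 m)).2)
      (fun m => (hiid m (hN3 m)).1) hp (DLRT.G₂_sub_G₁_sq_pos (show 3 ≤ N by lia))
      (a := fun _ => DLRT.G₁ N)
      (C := ∫ x, |x - ∫ y, y ∂(DLRT.logTermLaw N)| ^ 3 ∂(DLRT.logTermLaw N))
      (.of_forall fun m => DLRT.memLp_logTermLaw (hN3 m))
      (.of_forall fun m => by rw [hNm m])
      (by simp only [hNm, DLRT.variance_logTermLaw_eq (show 3 ≤ N by lia)]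
          exact tendsto_const_nhds)
      (by simp [hNm, DLRT.integral_id_logTermLaw (show 3 ≤ N by lia)])
    simpa only [DLRT.T₂_eq_sum_logTerm] using h
  · intro k hk hkν hN hp hpN
    have hN3 (m : ℕ) : 3 ≤ n₁ m + n₂ m := by
      have h1 : (1 : ℝ) ≤ k := by exact_mod_cast hk
      have h2 := hkν m
      have h3 : (2 : ℝ) < (n₁ m + n₂ m : ℕ) := by unfold DLRT.nu₂ at h2; linarith
      exact_mod_cast h3
    have (m : ℕ) := DLRT.isProbabilityMeasure_logTermLaw (hN3 m)
    obtain ⟨C, hC⟩ := DLRT.exists_eventually_integral_abs_pow_three_le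
    have h := DLRT.tendstoInDistribution_of_iid_rows (fun m => (hiid m (hN3 m)).2)
      (fun m => (hiid m (hN3 m)).1) hp two_pos
      (a := fun m => DLRT.eta (n₁ m + n₂ m) k)
      (.of_forall fun m => DLRT.memLp_logTermLaw (hN3 m)) (hN.eventually hC)
      (DLRT.tendsto_variance_logTermLaw.comp hN)
      (by simpa only [DLRT.integral_id_logTermLaw (hN3 _)] using
        DLRT.tendsto_sqrt_mul_G₁_sub_eta hN k hpN)
    simpa only [DLRT.T₂_eq_sum_logTerm, mul_comm (2 : ℝ)] using h
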